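/- All manifolds, forms, vector fields and tensor fields are smooth. A contact pair of type $(h,k)$ on a $(2h+2k+2)$-dimensional manifold $M$ is a pair of $1$-forms $(\alpha_1,\alpha_2)$ such that $\alpha_1\wedge(d\alpha_1)^h\wedge\alpha_2\wedge(d\alpha_2)^k$ vanishes nowhere, $(d\alpha_1)^{h+1}=0$ and $(d\alpha_2)^{k+1}=0$. Its Reeb vector fields $Z_1,Z_2$ are the unique vector fields with $\alpha_i(Z_j)=\delta_{ij}$ and $i_{Z_j}d\alpha_i=0$ for $i,j\in\{1,2\}$. A contact pair structure is a triple $(\alpha_1,\alpha_2,\phi)$, where $(\alpha_1,\alpha_2)$ is a contact pair and $\phi$ is a tensor field of type $(1,1)$ with $\phi^2=-\mathrm{Id}+\alpha_1\otimes Z_1+\alpha_2\otimes Z_2$ and $\phi(Z_1)=\phi(Z_2)=0$. It is a normal contact pair if the Nijenhuis tensors of both almost complex structures $J=\phi-\alpha_2\otimes Z_1+\alpha_1\otimes Z_2$ and $T=\phi+\alpha_2\otimes Z_1-\alpha_1\otimes Z_2$ vanish identically. The characteristic foliation $\mathcal F_2$ of $\alpha_2$ is the foliation tangent to $\ker\alpha_2\cap\ker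 d\alpha_2$; its leaves are the maximal connected (injectively immersed) integral manifolds of this distribution. An almost contact structure $(\alpha,Z,\phi)$ on a manifold $N$ (that is, $\phi^2=-\mathrm{Id}+\alpha\otimes Z$, $\phi(Z)=0$, $\alpha(Z)=1$) is normal if the almost complex structure $X+f\frac{d}{dt}\mapsto \phi X-fZ+\alpha(X)\frac{d}{dt}$ on $N\times\mathbb R$ is integrable, i.e. has vanishing Nijenhuis tensor. **Theorem.** Let $h\ge 0$ and let $(\alpha_1,\alpha_2,\phi)$ be a contact pair structure of type $(h,0)$ on a manifold $M$ of dimension $2h+2$, with Reeb vector fields $Z_1,Z_2$, such that the Lie derivative $L_{Z_2}\phi$ vanishes. Then $(\alpha_1,\alpha_2,\phi)$ is a normal contact pair if and only if on every leaf of $\mathcal F_2$ the triple $(\alpha_1,Z_1,\phi)$ induces (by restriction to the leaf) an almost contact structure which is normal. -/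

import Mathlib

open scoped Manifold ContDiff Bundle

universe u

noncomputable section

namespace ContactPairs

/-! ### Tensor fields on a smooth manifold -/

section Tensors

variable {E : Type*} [NormedAddCommGroup E] [NormedSpace ℝ E]
  {H : Type*} [TopologicalSpace H] (I : ModelWithCorners ℝ E H)
  (M : Type*) [TopologicalSpace M] [ChartedSpace H M]

/-- Fields of tangent vectors (no regularity). -/
abbrev VecField := Π x : M, TangentSpace I x

/-- Fields of linear forms on the tangent spaces (no regularity). -/
abbrev OneForm := Π x : M, TangentSpace I x →L[ℝ] ℝ

/-- Fields of endomorphisms of the tangent spaces, i.e. tensor fields of type `(1,1)`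
(no regularity). -/
abbrev EndoField := Π x : M, TangentSpace I x →L[ℝ] TangentSpace I x

variable {M}

/-- `X` is a smooth vector field, `X ∈ Γ(TM)`. -/
def SmoothVecField [IsManifold I ∞ M] (X : VecField I M) : Prop :=
  ContMDiff I I.tangent ∞ (fun x => (⟨x, X x⟩ : TangentBundle I M))

/-- `α` is a smooth `1`-form: a smooth section of the cotangent bundle. -/
def SmoothOneForm [IsManifold I ∞ M] (α : OneForm I M) : Prop :=
  ContMDiff I (I.prod 𝓘(ℝ, E →L[ℝ] ℝ)) ∞
    (fun x => Bundle.TotalSpace.mk' (E →L[ℝ] ℝ)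
      (E := fun x : M => (TangentSpace I x →L[ℝ] ℝ)) x (α x))

/-- `φ` is a smooth tensor field of type `(1,1)`: a smooth section of the bundle `End(TM)`. -/
def SmoothEndoField [IsManifold I ∞ M] (φ : EndoField I M) : Prop :=
  ContMDiff I (I.prod 𝓘(ℝ, E →L[ℝ] E)) ∞
    (fun x => Bundle.TotalSpace.mk' (E →L[ℝ] E)
      (E := fun x : M => (TangentSpace I x →L[ℝ] TangentSpace I x)) x (φ x))

/-- `[φ, φ](X, Y) = [φX, φY] - φ[φX, Y] - φ[X, φY] + φ²[X, Y]`. -/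
def nijenhuis (φ : EndoField I M) (X Y : VecField I M) : VecField I M := fun x =>
  VectorField.mlieBracket I (fun y => φ y (X y)) (fun y => φ y (Y y)) x
    - φ x (VectorField.mlieBracket I (fun y => φ y (X y)) Y x)
    - φ x (VectorField.mlieBracket I X (fun y => φ y (Y y)) x)
    + φ x (φ x (VectorField.mlieBracket I X Y x))

/-- The Nijenhuis tensor of `φ` vanishes identically. For an almost complex structure this is
its integrability. -/
def NijenhuisVanishes [IsManifold I ∞ M] (φ : EndoField I M) : Prop :=
  ∀ X Y : VecField I M, SmoothVecField I X → SmoothVecField I Y →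
    ∀ x, nijenhuis I φ X Y x = 0

/-- `(L_Z φ)(X) = [Z, φX] - φ[Z, X]`. -/
def lieDerivEndo (Z : VecField I M) (φ : EndoField I M) (X : VecField I M) : VecField I M :=
  fun x => VectorField.mlieBracket I Z (fun y => φ y (X y)) x
    - φ x (VectorField.mlieBracket I Z X x)

/-- `L_Z φ = 0`. -/
def LieDerivEndoVanishes [IsManifold I ∞ M] (Z : VecField I M) (φ : EndoField I M) : Prop :=
  ∀ X : VecField I M, SmoothVecField I X → ∀ x, lieDerivEndo I Z φ X x = 0

end Tensors

/-! ### Wedge products of alternating forms on a vector space -/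

section Wedge

variable {V : Type*} [AddCommGroup V] [Module ℝ V]

/-- The wedge product of real-valued alternating forms (sum over shuffles). -/
def wedge {p q : ℕ} (a : V [⋀^Fin p]→ₗ[ℝ] ℝ) (b : V [⋀^Fin q]→ₗ[ℝ] ℝ) :
    V [⋀^Fin (p + q)]→ₗ[ℝ] ℝ :=
  ((LinearMap.mul' ℝ ℝ).compAlternatingMap (a.domCoprod b)).domDomCongr finSumFinEquiv

/-- A linear form as an alternating form of degree `1`. -/
def linAlt (a : V →ₗ[ℝ] ℝ) : V [⋀^Fin 1]→ₗ[ℝ] ℝ :=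
  AlternatingMap.ofSubsingleton ℝ V ℝ (0 : Fin 1) a

/-- The `m`-th wedge power of a form of degree `2`. -/
def wedgePow (w : V [⋀^Fin 2]→ₗ[ℝ] ℝ) : (m : ℕ) → V [⋀^Fin (2 * m)]→ₗ[ℝ] ℝ
  | 0 => AlternatingMap.constOfIsEmpty ℝ V (Fin 0) 1
  | m + 1 => wedge (wedgePow w m) w

end Wedge

/-! ### Exterior derivative of a 1-form -/

section ExteriorDerivative

variable {n : ℕ} {M : Type*} [TopologicalSpace M] [ChartedSpace (EuclideanSpace ℝ (Fin n)) M]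

/-- The coordinate expression of `α` in the chart at `x`, as a form on (an open subset of) `ℝⁿ`:
the pullback of `α` by the inverse of the chart. -/
def coordForm (α : OneForm (𝓡 n) M) (x : M) (y : EuclideanSpace ℝ (Fin n)) :
    EuclideanSpace ℝ (Fin n) [⋀^Fin 1]→L[ℝ] ℝ :=
  ContinuousAlternatingMap.ofSubsingleton ℝ (EuclideanSpace ℝ (Fin n)) ℝ (0 : Fin 1)
    ((α ((extChartAt (𝓡 n) x).symm y)).comp
      (mfderiv 𝓘(ℝ, EuclideanSpace ℝ (Fin n)) (𝓡 n) (extChartAt (𝓡 n) x).symm y))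

/-- The exterior derivative of a `1`-form, at `x`, computed in the chart at `x`. -/
def extD (α : OneForm (𝓡 n) M) (x : M) : TangentSpace (𝓡 n) x [⋀^Fin 2]→L[ℝ] ℝ :=
  (extDeriv (coordForm α x) (extChartAt (𝓡 n) x x)).compContinuousLinearMap
    (mfderiv (𝓡 n) 𝓘(ℝ, EuclideanSpace ℝ (Fin n)) (extChartAt (𝓡 n) x) x)

end ExteriorDerivative

/-! ### Contact pairs -/

section ContactPair

variable {n : ℕ} {M : Type*} [TopologicalSpace M] [ChartedSpace (EuclideanSpace ℝ (Fin n)) M]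

/-- `α₁ ∧ (dα₁)ʰ ∧ α₂ ∧ (dα₂)ᵏ` at `x`. -/
def contactPairForm (h k : ℕ) (α₁ α₂ : OneForm (𝓡 n) M) (x : M) :
    TangentSpace (𝓡 n) x [⋀^Fin (1 + 2 * h + 1 + 2 * k)]→ₗ[ℝ] ℝ :=
  wedge (wedge (wedge (linAlt (α₁ x).toLinearMap) (wedgePow (extD α₁ x).toAlternatingMap h))
    (linAlt (α₂ x).toLinearMap)) (wedgePow (extD α₂ x).toAlternatingMap k)

/-- `(α₁, α₂)` is a contact pair of type `(h,k)` on the `(2h+2k+2)`-dimensional manifold `M`. -/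
structure IsContactPair [IsManifold (𝓡 n) ∞ M] (h k : ℕ) (α₁ α₂ : OneForm (𝓡 n) M) : Prop where
  dim : n = 2 * h + 2 * k + 2
  smooth₁ : SmoothOneForm (𝓡 n) α₁
  smooth₂ : SmoothOneForm (𝓡 n) α₂
  volume : ∀ x, contactPairForm h k α₁ α₂ x ≠ 0
  power₁ : ∀ x, wedgePow (extD α₁ x).toAlternatingMap (h + 1) = 0
  power₂ : ∀ x, wedgePow (extD α₂ x).toAlternatingMap (k + 1) = 0

/-- The equations that determine the Reeb vector fields `Z₁`, `Z₂` of a contact pair. -/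
structure IsReebPair [IsManifold (𝓡 n) ∞ M] (α₁ α₂ : OneForm (𝓡 n) M) (Z₁ Z₂ : VecField (𝓡 n) M) : Prop where
  smooth₁ : SmoothVecField (𝓡 n) Z₁
  smooth₂ : SmoothVecField (𝓡 n) Z₂
  pairing₁₁ : ∀ x, α₁ x (Z₁ x) = 1
  pairing₂₂ : ∀ x, α₂ x (Z₂ x) = 1
  pairing₁₂ : ∀ x, α₁ x (Z₂ x) = 0
  pairing₂₁ : ∀ x, α₂ x (Z₁ x) = 0
  contraction₁₁ : ∀ x (v : TangentSpace (𝓡 n) x), extD α₁ x ![Z₁ x, v] = 0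
  contraction₁₂ : ∀ x (v : TangentSpace (𝓡 n) x), extD α₂ x ![Z₁ x, v] = 0
  contraction₂₁ : ∀ x (v : TangentSpace (𝓡 n) x), extD α₁ x ![Z₂ x, v] = 0
  contraction₂₂ : ∀ x (v : TangentSpace (𝓡 n) x), extD α₂ x ![Z₂ x, v] = 0

/-- The distribution `ker α ∩ ker dα` tangent to the characteristic foliation of `α`. -/
def charDistribution (α : OneForm (𝓡 n) M) (x : M) : Submodule ℝ (TangentSpace (𝓡 n) x) where
  carrier := {v | α x v = 0 ∧ ∀ w, extD α x ![v, w] = 0}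
  zero_mem' := ⟨map_zero _, fun w => (extD α x).map_coord_zero 0 rfl⟩
  add_mem' := by
    rintro a b ⟨ha, ha'⟩ ⟨hb, hb'⟩
    refine ⟨by rw [map_add, ha, hb, add_zero], fun w => ?_⟩
    have := (extD α x).toAlternatingMap.map_vecCons_add ![w] a b
    exact this.trans ((congrArg₂ (· + ·) (ha' w) (hb' w)).trans (add_zero _))
  smul_mem' := by
    rintro c a ⟨ha, ha'⟩
    refine ⟨by rw [map_smul, ha, smul_zero], fun w => ?_⟩
    have := (extD α x).toAlternatingMap.map_vecCons_smul ![w] c a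
    exact this.trans ((congrArg (c • ·) (ha' w)).trans (smul_zero _))

end ContactPair

/-- A contact pair structure `(α₁, α₂, φ)` of type `(h,k)` on `M`, together with the
(uniquely determined) Reeb vector fields `Z₁`, `Z₂` of the contact pair `(α₁, α₂)`. -/
structure ContactPairStructure (n h k : ℕ) (M : Type*) [TopologicalSpace M]
    [ChartedSpace (EuclideanSpace ℝ (Fin n)) M] [IsManifold (𝓡 n) ∞ M] where
  α₁ : OneForm (𝓡 n) M
  α₂ : OneForm (𝓡 n) M
  φ : EndoField (𝓡 n) M
  Z₁ : VecField (𝓡 n) M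
  Z₂ : VecField (𝓡 n) M
  isContactPair : IsContactPair h k α₁ α₂
  isReebPair : IsReebPair α₁ α₂ Z₁ Z₂
  smooth_φ : SmoothEndoField (𝓡 n) φ
  φ_sq : ∀ x (v : TangentSpace (𝓡 n) x),
    φ x (φ x v) = -v + α₁ x v • Z₁ x + α₂ x v • Z₂ x
  φ_Z₁ : ∀ x, φ x (Z₁ x) = 0
  φ_Z₂ : ∀ x, φ x (Z₂ x) = 0

namespace ContactPairStructure

variable {h k n : ℕ} {M : Type*} [TopologicalSpace M]
  [ChartedSpace (EuclideanSpace ℝ (Fin n)) M] [IsManifold (𝓡 n) ∞ M]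

/-- `J = φ - α₂ ⊗ Z₁ + α₁ ⊗ Z₂`. -/
def J (S : ContactPairStructure n h k M) : EndoField (𝓡 n) M := fun x =>
  S.φ x - (S.α₂ x).smulRight (S.Z₁ x) + (S.α₁ x).smulRight (S.Z₂ x)

/-- `T = φ + α₂ ⊗ Z₁ - α₁ ⊗ Z₂`. -/
def T (S : ContactPairStructure n h k M) : EndoField (𝓡 n) M := fun x =>
  S.φ x + (S.α₂ x).smulRight (S.Z₁ x) - (S.α₁ x).smulRight (S.Z₂ x)

/-- The structure is a normal contact pair: the Nijenhuis tensors of `J` and `T` vanish. -/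
def IsNormal (S : ContactPairStructure n h k M) : Prop :=
  NijenhuisVanishes (𝓡 n) S.J ∧ NijenhuisVanishes (𝓡 n) S.T

end ContactPairStructure

/-! ### Almost contact structures -/

/-- An almost contact structure `(α, Z, φ)` on `N`. -/
structure AlmostContactStructure (d : ℕ) (N : Type*) [TopologicalSpace N]
    [ChartedSpace (EuclideanSpace ℝ (Fin d)) N] [IsManifold (𝓡 d) ∞ N] where
  α : OneForm (𝓡 d) N
  Z : VecField (𝓡 d) N
  φ : EndoField (𝓡 d) N
  smooth_α : SmoothOneForm (𝓡 d) α
  smooth_Z : SmoothVecField (𝓡 d) Z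
  smooth_φ : SmoothEndoField (𝓡 d) φ
  φ_sq : ∀ x (v : TangentSpace (𝓡 d) x), φ x (φ x v) = -v + α x v • Z x
  φ_Z : ∀ x, φ x (Z x) = 0
  α_Z : ∀ x, α x (Z x) = 1

namespace AlmostContactStructure

variable {d : ℕ} {N : Type*} [TopologicalSpace N]
  [ChartedSpace (EuclideanSpace ℝ (Fin d)) N] [IsManifold (𝓡 d) ∞ N]

/-- The almost complex structure `J(X + f ∂ₜ) = φ X - f Z + α(X) ∂ₜ` on `N × ℝ`; the tangent
space of `N × ℝ` at `(x, t)` is `T_x N × ℝ`. -/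
def J (A : AlmostContactStructure d N) : EndoField ((𝓡 d).prod 𝓘(ℝ, ℝ)) (N × ℝ) := fun p =>
  (show (TangentSpace (𝓡 d) p.1 × ℝ) →L[ℝ] (TangentSpace (𝓡 d) p.1 × ℝ) from
    ((A.φ p.1).comp (ContinuousLinearMap.fst ℝ _ ℝ)
      - (ContinuousLinearMap.snd ℝ (TangentSpace (𝓡 d) p.1) ℝ).smulRight (A.Z p.1)).prod
    ((A.α p.1).comp (ContinuousLinearMap.fst ℝ _ ℝ)))

/-- The almost contact structure is normal: the almost complex structure on `N × ℝ` is
integrable. -/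
def IsNormal (A : AlmostContactStructure d N) : Prop :=
  NijenhuisVanishes ((𝓡 d).prod 𝓘(ℝ, ℝ)) A.J

end AlmostContactStructure

/-! ### Leaves -/

section Leaves

variable {n : ℕ} {M : Type u} [TopologicalSpace M] [ChartedSpace (EuclideanSpace ℝ (Fin n)) M]

/-- `i : L → M` exhibits the connected `d`-dimensional manifold `L` as an integral manifold of the
distribution `D`: an injective immersion such that `di(T_x L) = D (i x)` for all `x`. -/
structure IsConnectedIntegralManifold (d : ℕ) (D : Π x : M, Submodule ℝ (TangentSpace (𝓡 n) x))
    {L : Type u} [TopologicalSpace L] [ChartedSpace (EuclideanSpace ℝ (Fin d)) L]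
    (i : L → M) : Prop where
  connected : ConnectedSpace L
  smooth : ContMDiff (𝓡 d) (𝓡 n) ∞ i
  injective : Function.Injective i
  immersion : ∀ x, Function.Injective (mfderiv (𝓡 d) (𝓡 n) i x)
  tangent : ∀ x, (mfderiv (𝓡 d) (𝓡 n) i x).range = D (i x)

/-- `i : L → M` is a leaf: a maximal connected integral manifold of the distribution `D`.
Being injectively immersed in `M` and connected, `L` is Hausdorff and second countable as soon as
`M` is. -/
structure IsLeaf (d : ℕ) (D : Π x : M, Submodule ℝ (TangentSpace (𝓡 n) x))
    {L : Type u} [TopologicalSpace L] [ChartedSpace (EuclideanSpace ℝ (Fin d)) L]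
    (i : L → M) : Prop extends IsConnectedIntegralManifold d D i where
  maximal : ∀ (N : Type u) [TopologicalSpace N] [ChartedSpace (EuclideanSpace ℝ (Fin d)) N]
    [IsManifold (𝓡 d) ∞ N] (j : N → M), IsConnectedIntegralManifold d D j →
    Set.range i ⊆ Set.range j → Set.range j ⊆ Set.range i

/-- `A` is the structure induced by `(α₁, Z₁, φ)` on the immersed submanifold `i : L → M`:
`α = i^* α₁`, `di(Z) = Z₁` and `di(φ v) = φ(di v)`. Since `di` is injective these equations
determine `A`. -/
structure IsInduced {h k d : ℕ} [IsManifold (𝓡 n) ∞ M] (S : ContactPairStructure n h k M)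
    {L : Type u} [TopologicalSpace L] [ChartedSpace (EuclideanSpace ℝ (Fin d)) L]
    [IsManifold (𝓡 d) ∞ L] (i : L → M) (A : AlmostContactStructure d L) : Prop where
  form : ∀ x (v : TangentSpace (𝓡 d) x), A.α x v = S.α₁ (i x) (mfderiv (𝓡 d) (𝓡 n) i x v)
  reeb : ∀ x, mfderiv (𝓡 d) (𝓡 n) i x (A.Z x) = S.Z₁ (i x)
  tensor : ∀ x (v : TangentSpace (𝓡 d) x),
    mfderiv (𝓡 d) (𝓡 n) i x (A.φ x v) = S.φ (i x) (mfderiv (𝓡 d) (𝓡 n) i x v)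

end Leaves

end ContactPairs

end

noncomputable section

open Set Filter Topology VectorField

namespace ContactPairs

section Bracket

variable {E : Type*} [NormedAddCommGroup E] [NormedSpace ℝ E]
  {H : Type*} [TopologicalSpace H] {I : ModelWithCorners ℝ E H}
  {M : Type*} [TopologicalSpace M] [ChartedSpace H M]
  {F : Type*} [NormedAddCommGroup F] [NormedSpace ℝ F]

variable (I) in
/-- The expression of the vector field `V` in the chart at `x`. -/
def coordField (V : VecField I M) (x : M) (y : E) : E :=
  mpullbackWithin 𝓘(ℝ, E) I (extChartAt I x).symm V (range I) y

lemma coordField_self [IsManifold I 1 M] (V : VecField I M) (x : M) :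
    coordField I V x (extChartAt I x x) = V x := by
  have h := mfderivWithin_extChartAt_symm_inverse_apply (I := I) (x := x)
    (V ((extChartAt I x).symm (extChartAt I x x)))
  refine Eq.trans h ?_
  rw [extChartAt_to_inv]

lemma mlieBracket_eq_lieBracket_coordField [I.Boundaryless] [IsManifold I 1 M]
    (V W : VecField I M) (x : M) :
    mlieBracket I V W x
      = lieBracket ℝ (coordField I V x) (coordField I W x) (extChartAt I x x) := by
  have hinv (v : TangentSpace 𝓘(ℝ, E) (extChartAt I x x)) :
      (mfderiv I 𝓘(ℝ, E) (extChartAt I x) x).inverse v = (show TangentSpace I x from v) := by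
    refine (isInvertible_mfderiv_extChartAt (mem_extChartAt_source x)).inverse_apply_eq.2 ?_
    exact (congrArg (fun A : E →L[ℝ] E => A v) (mfderiv_extChartAt_self (I := I) (x := x))).symm
  refine (hinv _).trans ?_
  change lieBracketWithin ℝ (coordField I V x) (coordField I W x)
    ((extChartAt I x).symm ⁻¹' univ ∩ range I) (extChartAt I x x) = _
  rw [preimage_univ, univ_inter, I.range_eq_univ, lieBracketWithin_univ]

lemma differentiableAt_coordField [CompleteSpace E] [I.Boundaryless] [IsManifold I 2 M]
    {V : VecField I M} {x : M}
    (hV : MDifferentiableAt I I.tangent (fun y => (⟨y, V y⟩ : TangentBundle I M)) x) :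
    DifferentiableAt ℝ (coordField I V x) (extChartAt I x x) := by
  have : DifferentiableWithinAt ℝ (coordField I V x) ((extChartAt I x).symm ⁻¹' univ ∩ range I)
      (extChartAt I x x) :=
    (hV.mdifferentiableWithinAt (s := univ)).differentiableWithinAt_mpullbackWithin_vectorField
  rwa [preimage_univ, univ_inter, I.range_eq_univ, differentiableWithinAt_univ] at this

lemma mfderivWithin_coordField [IsManifold I 1 M] (V : VecField I M) (x : M) {y : E}
    (hy : y ∈ (extChartAt I x).target) :
    mfderivWithin 𝓘(ℝ, E) I (extChartAt I x).symm (range I) y (coordField I V x y : E)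
      = V ((extChartAt I x).symm y) :=
  ((isInvertible_mfderivWithin_extChartAt_symm (I := I) hy).inverse_apply_eq.1 rfl).symm

lemma mvfderiv_comp_extChartAt [IsManifold I 1 M] {x : M} {f : E → F}
    (hf : DifferentiableAt ℝ f (extChartAt I x x)) (v : TangentSpace I x) :
    mvfderiv I (f ∘ extChartAt I x) x v = fderiv ℝ f (extChartAt I x x) v := by
  have h1 : MDifferentiableAt 𝓘(ℝ, E) 𝓘(ℝ, F) f (extChartAt I x x) := hf.mdifferentiableAt
  have h2 := mdifferentiableAt_extChartAt (I := I) (mem_chart_source H x)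
  have h3 : mfderiv I 𝓘(ℝ, F) (f ∘ extChartAt I x) x v = _ := mfderiv_comp_apply x h1 h2 v
  refine h3.trans ?_
  rw [mfderiv_eq_fderiv]
  exact congrArg (fun A : E →L[ℝ] E => fderiv ℝ f (extChartAt I x x) (A v))
    (mfderiv_extChartAt_self (I := I) (x := x))

lemma mvfderiv_eq_fderiv_comp_symm [I.Boundaryless] {x : M} {f : M → F}
    (hf : MDifferentiableAt I 𝓘(ℝ, F) f x) (v : TangentSpace I x) :
    mvfderiv I f x v = fderiv ℝ (f ∘ (extChartAt I x).symm) (extChartAt I x x) v := by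
  rw [hf.mvfderiv, I.range_eq_univ, fderivWithin_univ]
  rfl

lemma fderiv_comp_symm_coordField [I.Boundaryless] [IsManifold I 1 M] {x : M} {f : M → F}
    (V : VecField I M) {y : E} (hy : y ∈ (extChartAt I x).target)
    (hf : MDifferentiableAt I 𝓘(ℝ, F) f ((extChartAt I x).symm y)) :
    fderiv ℝ (f ∘ (extChartAt I x).symm) y (coordField I V x y)
      = mvfderiv I f ((extChartAt I x).symm y) (V ((extChartAt I x).symm y)) := by
  have h1 := mdifferentiableWithinAt_extChartAt_symm (I := I) hy
  have h2 := mfderiv_comp_mfderivWithin y hf h1 (I.uniqueMDiffOn y (by simp [I.range_eq_univ]))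
  rw [← mfderivWithin_coordField V x hy]
  rw [I.range_eq_univ] at h2 ⊢
  rw [mfderivWithin_univ, mfderiv_eq_fderiv] at h2
  exact congrArg (fun A : E →L[ℝ] F => A (coordField I V x y)) h2

lemma contDiffAt_comp_extChartAt_symm [I.Boundaryless] {n : WithTop ℕ∞} {x : M} {f : M → F}
    (hf : ContMDiffAt I 𝓘(ℝ, F) n f x) :
    ContDiffAt ℝ n (f ∘ (extChartAt I x).symm) (extChartAt I x x) := by
  have := (contMDiffAt_iff.1 hf).2
  rw [I.range_eq_univ, contDiffWithinAt_univ] at this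
  exact this

lemma mvfderiv_apply_eventuallyEq [I.Boundaryless] [IsManifold I 2 M] {x : M} {g : M → F}
    (hg : ContMDiffAt I 𝓘(ℝ, F) 2 g x) (U : VecField I M) :
    (fun y => mvfderiv I g y (U y)) =ᶠ[𝓝 x] (fun y => fderiv ℝ (g ∘ (extChartAt I x).symm) y
      (coordField I U x y)) ∘ extChartAt I x := by
  have : IsManifold I 1 M := .of_le (n := 2) (by norm_num)
  filter_upwards [contMDiffAt_iff_contMDiffAt_nhds (by simp) |>.1 hg,
    extChartAt_source_mem_nhds (I := I) x] with z hz hzs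
  have hz' := (extChartAt I x).left_inv hzs
  have := fderiv_comp_symm_coordField (f := g) U ((extChartAt I x).map_source hzs)
    (by rw [hz']; exact hz.mdifferentiableAt (by simp))
  rw [hz'] at this
  exact this.symm

lemma differentiableAt_fderiv_coordField [CompleteSpace E] [I.Boundaryless] [IsManifold I 2 M]
    {x : M} {g : M → F} (hg : ContMDiffAt I 𝓘(ℝ, F) 2 g x) {U : VecField I M}
    (hU : MDifferentiableAt I I.tangent (fun y => (⟨y, U y⟩ : TangentBundle I M)) x) :
    DifferentiableAt ℝ (fun y => fderiv ℝ (g ∘ (extChartAt I x).symm) y (coordField I U x y))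
      (extChartAt I x x) :=
  (((contDiffAt_comp_extChartAt_symm hg).fderiv_right (m := 1)
    (by norm_num)).differentiableAt (by simp)).clm_apply (differentiableAt_coordField hU)

lemma mdifferentiableAt_mvfderiv_apply [CompleteSpace E] [I.Boundaryless] [IsManifold I 2 M]
    {x : M} {g : M → F} (hg : ContMDiffAt I 𝓘(ℝ, F) 2 g x) {U : VecField I M}
    (hU : MDifferentiableAt I I.tangent (fun y => (⟨y, U y⟩ : TangentBundle I M)) x) :
    MDifferentiableAt I 𝓘(ℝ, F) (fun y => mvfderiv I g y (U y)) x := by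
  have : IsManifold I 1 M := .of_le (n := 2) (by norm_num)
  have h := (differentiableAt_fderiv_coordField hg hU).mdifferentiableAt.comp x
    (mdifferentiableAt_extChartAt (I := I) (mem_chart_source H x))
  exact h.congr_of_eventuallyEq (mvfderiv_apply_eventuallyEq hg U)

lemma mvfderiv_congr {x : M} {f g : M → F} (h : f =ᶠ[𝓝 x] g) (v : TangentSpace I x) :
    mvfderiv I f x v = mvfderiv I g x v :=
  congrArg (fun A : E →L[ℝ] F => A v) (h.mfderiv_eq (I := I) (I' := 𝓘(ℝ, F)))

/-- Differentiation along `[V, W]` is the commutator of the differentiations along `V`, `W`. -/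
theorem mvfderiv_mlieBracket [CompleteSpace E] [I.Boundaryless] [IsManifold I 2 M]
    {V W : VecField I M} {x : M} {g : M → F} (hg : ContMDiffAt I 𝓘(ℝ, F) 2 g x)
    (hV : MDifferentiableAt I I.tangent (fun y => (⟨y, V y⟩ : TangentBundle I M)) x)
    (hW : MDifferentiableAt I I.tangent (fun y => (⟨y, W y⟩ : TangentBundle I M)) x) :
    mvfderiv I g x (mlieBracket I V W x)
      = mvfderiv I (fun y => mvfderiv I g y (W y)) x (V x)
        - mvfderiv I (fun y => mvfderiv I g y (V y)) x (W x) := by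
  have : IsManifold I 1 M := .of_le (n := 2) (by norm_num)
  rw [mvfderiv_congr (mvfderiv_apply_eventuallyEq hg W),
    mvfderiv_congr (mvfderiv_apply_eventuallyEq hg V),
    mvfderiv_comp_extChartAt (differentiableAt_fderiv_coordField hg hW),
    mvfderiv_comp_extChartAt (differentiableAt_fderiv_coordField hg hV),
    mvfderiv_eq_fderiv_comp_symm (hg.mdifferentiableAt (by simp)),
    mlieBracket_eq_lieBracket_coordField]
  refine (fderiv_apply_lieBracket (contDiffAt_comp_extChartAt_symm hg) (by simp)
    (differentiableAt_coordField hW) (differentiableAt_coordField hV)).trans ?_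
  rw [coordField_self, coordField_self]

variable {E' : Type*} [NormedAddCommGroup E'] [NormedSpace ℝ E']
  {H' : Type*} [TopologicalSpace H'] {I' : ModelWithCorners ℝ E' H'}
  {M' : Type*} [TopologicalSpace M'] [ChartedSpace H' M']

lemma mvfderiv_comp_apply' {f : M → M'} {g : M' → F} {x : M}
    (hg : MDifferentiableAt I' 𝓘(ℝ, F) g (f x)) (hf : MDifferentiableAt I I' f x)
    (v : TangentSpace I x) :
    mvfderiv I (fun y => g (f y)) x v = mvfderiv I' g (f x) (mfderiv I I' f x v) :=
  mfderiv_comp_apply x hg hf v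

/-- The Lie brackets of `f`-related vector fields are `f`-related. -/
theorem mfderiv_mlieBracket_of_related [CompleteSpace E] [I.Boundaryless] [IsManifold I 2 M]
    [CompleteSpace E'] [I'.Boundaryless] [IsManifold I' 2 M'] {f : M → M'}
    {V W : VecField I M} {V' W' : VecField I' M'} {x : M} (hf : ContMDiffAt I I' 2 f x)
    (hV : MDifferentiableAt I I.tangent (fun y => (⟨y, V y⟩ : TangentBundle I M)) x)
    (hW : MDifferentiableAt I I.tangent (fun y => (⟨y, W y⟩ : TangentBundle I M)) x)
    (hV' : MDifferentiableAt I' I'.tangent (fun y => (⟨y, V' y⟩ : TangentBundle I' M')) (f x))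
    (hW' : MDifferentiableAt I' I'.tangent (fun y => (⟨y, W' y⟩ : TangentBundle I' M')) (f x))
    (hVV' : ∀ y, mfderiv I I' f y (V y) = V' (f y))
    (hWW' : ∀ y, mfderiv I I' f y (W y) = W' (f y)) :
    mfderiv I I' f x (mlieBracket I V W x) = mlieBracket I' V' W' (f x) := by
  have : IsManifold I' 1 M' := .of_le (n := 2) (by norm_num)
  set φ := extChartAt I' (f x) with hφ
  have hφs : ContMDiffAt I' 𝓘(ℝ, E') 2 φ (f x) := contMDiffAt_extChartAt
  have hφf : ContMDiffAt I 𝓘(ℝ, E') 2 (fun y => φ (f y)) x := hφs.comp x hf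
  have hev (U : VecField I M) (U' : VecField I' M')
      (hU' : MDifferentiableAt I' I'.tangent (fun y => (⟨y, U' y⟩ : TangentBundle I' M')) (f x))
      (hUU' : ∀ y, mfderiv I I' f y (U y) = U' (f y)) (v : TangentSpace I x) :
      mvfderiv I (fun y => mvfderiv I (fun y => φ (f y)) y (U y)) x v
        = mvfderiv I' (fun y => mvfderiv I' φ y (U' y)) (f x) (mfderiv I I' f x v) := by
    rw [← mvfderiv_comp_apply' (mdifferentiableAt_mvfderiv_apply hφs hU')
      (hf.mdifferentiableAt (by simp))]
    apply mvfderiv_congr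
    filter_upwards [contMDiffAt_iff_contMDiffAt_nhds (by simp) |>.1 hf,
      hf.continuousAt.eventually (contMDiffAt_iff_contMDiffAt_nhds (by simp) |>.1 hφs)]
      with y hy hy'
    rw [mvfderiv_comp_apply' (hy'.mdifferentiableAt (by simp)) (hy.mdifferentiableAt (by simp)),
      hUU']
  have h1 := mvfderiv_mlieBracket hφf hV hW
  rw [hev W W' hW' hWW', hev V V' hV' hVV', hVV', hWW', ← mvfderiv_mlieBracket hφs hV' hW',
    mvfderiv_comp_apply' (hφs.mdifferentiableAt (by simp)) (hf.mdifferentiableAt (by simp))] at h1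
  exact (isInvertible_mfderiv_extChartAt (mem_extChartAt_source (I := I') (f x))).injective h1

/-- The Lie bracket of two vector fields on a product with `ℝ` that are constant along `ℝ`. -/
theorem mlieBracket_prod_real [CompleteSpace E] [I.Boundaryless] [IsManifold I 2 M]
    {V W : VecField I M} {a b : M → ℝ}
    {p : M × ℝ}
    (hV : MDifferentiableAt I I.tangent (fun y => (⟨y, V y⟩ : TangentBundle I M)) p.1)
    (hW : MDifferentiableAt I I.tangent (fun y => (⟨y, W y⟩ : TangentBundle I M)) p.1)
    (hV' : MDifferentiableAt (I.prod 𝓘(ℝ, ℝ)) (I.prod 𝓘(ℝ, ℝ)).tangent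
      (fun q : M × ℝ => (⟨q, (V q.1, a q.1)⟩ : TangentBundle (I.prod 𝓘(ℝ, ℝ)) (M × ℝ))) p)
    (hW' : MDifferentiableAt (I.prod 𝓘(ℝ, ℝ)) (I.prod 𝓘(ℝ, ℝ)).tangent
      (fun q : M × ℝ => (⟨q, (W q.1, b q.1)⟩ : TangentBundle (I.prod 𝓘(ℝ, ℝ)) (M × ℝ))) p)
    (ha : MDifferentiableAt I 𝓘(ℝ, ℝ) a p.1) (hb : MDifferentiableAt I 𝓘(ℝ, ℝ) b p.1) :
    mlieBracket (I.prod 𝓘(ℝ, ℝ)) (fun q : M × ℝ => ((V q.1, a q.1) : E × ℝ))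
      (fun q : M × ℝ => ((W q.1, b q.1) : E × ℝ)) p
    = ((mlieBracket I V W p.1, mvfderiv I b p.1 (V p.1) - mvfderiv I a p.1 (W p.1)) : E × ℝ) := by
  have h1 := mfderiv_mlieBracket_of_related (f := (Prod.fst : M × ℝ → M)) (V' := V) (W' := W)
    (x := p) contMDiffAt_fst hV' hW' hV hW
    (fun y => by rw [mfderiv_fst]; rfl) (fun y => by rw [mfderiv_fst]; rfl)
  have h2 := mvfderiv_mlieBracket (g := (Prod.snd : M × ℝ → ℝ)) contMDiffAt_snd hV' hW'
  have hc (c : M → ℝ) (hc : MDifferentiableAt I 𝓘(ℝ, ℝ) c p.1) (U : VecField I M)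
      (v : E × ℝ) :
      mvfderiv (I.prod 𝓘(ℝ, ℝ)) (fun y : M × ℝ => mvfderiv (I.prod 𝓘(ℝ, ℝ))
        (Prod.snd : M × ℝ → ℝ) y ((U y.1, c y.1) : E × ℝ)) p v = mvfderiv I c p.1 v.1 := by
    have : (fun y : M × ℝ => mvfderiv (I.prod 𝓘(ℝ, ℝ))
        (Prod.snd : M × ℝ → ℝ) y ((U y.1, c y.1) : E × ℝ)) = fun y => c y.1 := by
      funext y
      unfold mvfderiv
      rw [mfderiv_snd]
      rfl
    rw [this]
    refine (mvfderiv_comp_apply' (f := Prod.fst) hc mdifferentiableAt_fst _).trans ?_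
    rw [mfderiv_fst]
    rfl
  refine Prod.ext ?_ ?_
  · rw [mfderiv_fst] at h1
    exact h1
  · rw [hc b hb W, hc a ha V] at h2
    unfold mvfderiv at h2
    rw [mfderiv_snd] at h2
    exact h2

end Bracket

section Nijenhuis

variable {E : Type*} [NormedAddCommGroup E] [NormedSpace ℝ E] [FiniteDimensional ℝ E]
  {H : Type*} [TopologicalSpace H] {I : ModelWithCorners ℝ E H}
  {M : Type*} [TopologicalSpace M] [ChartedSpace H M] [IsManifold I ∞ M]

omit [FiniteDimensional ℝ E] in
variable (I) in
/-- The vector field `X` is differentiable at `x`. -/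
abbrev DiffFieldAt (X : VecField I M) (x : M) : Prop :=
  MDifferentiableAt I I.tangent (fun y => (⟨y, X y⟩ : TangentBundle I M)) x

omit [FiniteDimensional ℝ E] [IsManifold I ∞ M] in
lemma nijenhuis_swap (φ : EndoField I M) (X Y : VecField I M) (x : M) :
    nijenhuis I φ X Y x = - nijenhuis I φ Y X x := by
  simp only [nijenhuis]
  rw [mlieBracket_swap_apply (V := fun y => φ y (X y)) (W := fun y => φ y (Y y)),
    mlieBracket_swap_apply (V := fun y => φ y (X y)) (W := Y),
    mlieBracket_swap_apply (V := X) (W := fun y => φ y (Y y)),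
    mlieBracket_swap_apply (V := X) (W := Y)]
  simp only [map_neg]
  abel

lemma tensorialAt_nijenhuis_left {φ : EndoField I M} {x : M}
    (hφ : ∀ X : VecField I M, DiffFieldAt I X x → DiffFieldAt I (fun y => φ y (X y)) x)
    (Y : VecField I M) :
    TensorialAt I E (fun X : VecField I M => nijenhuis I φ X Y x) x where
  smul {f X} hf hX := by
    have := FiniteDimensional.complete ℝ E
    have h1 : (fun y => φ y ((f • X) y)) = f • fun y => φ y (X y) := by
      funext y; simp
    simp only [nijenhuis, h1]
    rw [mlieBracket_smul_left hf (hφ X hX), mlieBracket_smul_left hf (hφ X hX),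
      mlieBracket_smul_left hf hX, mlieBracket_smul_left hf hX]
    simp only [map_add, map_smul, map_neg, neg_smul]
    module
  add {X X'} hX hX' := by
    have := FiniteDimensional.complete ℝ E
    have h1 : (fun y => φ y ((X + X') y)) = (fun y => φ y (X y)) + fun y => φ y (X' y) := by
      funext y; simp
    simp only [nijenhuis, h1]
    rw [mlieBracket_add_left (hφ X hX) (hφ X' hX'), mlieBracket_add_left (hφ X hX) (hφ X' hX'),
      mlieBracket_add_left hX hX', mlieBracket_add_left hX hX']
    simp only [map_add]
    abel

/-- The value of the Nijenhuis tensor at `x` depends only on the values of the fields at `x`. -/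
theorem nijenhuis_congr_of_eq {φ : EndoField I M} {x : M}
    (hφ : ∀ X : VecField I M, DiffFieldAt I X x → DiffFieldAt I (fun y => φ y (X y)) x)
    {X X' Y Y' : VecField I M} (hX : DiffFieldAt I X x) (hX' : DiffFieldAt I X' x)
    (hY : DiffFieldAt I Y x) (hY' : DiffFieldAt I Y' x) (hXX' : X x = X' x) (hYY' : Y x = Y' x) :
    nijenhuis I φ X Y x = nijenhuis I φ X' Y' x := by
  rw [(tensorialAt_nijenhuis_left hφ Y).pointwise hX hX' hXX', nijenhuis_swap,
    (tensorialAt_nijenhuis_left hφ X').pointwise hY hY' hYY', ← nijenhuis_swap]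

end Nijenhuis

section ExteriorDerivative

variable {n : ℕ} {M : Type*} [TopologicalSpace M] [ChartedSpace (EuclideanSpace ℝ (Fin n)) M]
  [IsManifold (𝓡 n) ∞ M]

/-- The coordinate expression of a `1`-form in the chart at `x`, as a map to the dual space. -/
def coordCovector (α : OneForm (𝓡 n) M) (x : M) (y : EuclideanSpace ℝ (Fin n)) :
    EuclideanSpace ℝ (Fin n) →L[ℝ] ℝ :=
  (α ((extChartAt (𝓡 n) x).symm y)).comp
      (mfderiv 𝓘(ℝ, EuclideanSpace ℝ (Fin n)) (𝓡 n) (extChartAt (𝓡 n) x).symm y)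

omit [IsManifold (𝓡 n) ∞ M] in
lemma coordForm_eq (α : OneForm (𝓡 n) M) (x : M) (y : EuclideanSpace ℝ (Fin n)) :
    coordForm α x y = ContinuousAlternatingMap.ofSubsingleton ℝ (EuclideanSpace ℝ (Fin n)) ℝ
      (0 : Fin 1) (coordCovector α x y) := rfl

lemma contDiffOn_coordCovector {α : OneForm (𝓡 n) M} (hα : SmoothOneForm (𝓡 n) α) (x : M) :
    ContDiffOn ℝ ∞ (coordCovector α x) (extChartAt (𝓡 n) x).target := by
  have h1 := (Bundle.Trivialization.contMDiffOn_section_baseSet_iff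
    (trivializationAt (EuclideanSpace ℝ (Fin n) →L[ℝ] ℝ)
      (fun z : M => (TangentSpace (𝓡 n) z →L[ℝ] ℝ)) x)).1 hα.contMDiffOn
  have h2 := h1.comp (contMDiffOn_extChartAt_symm (I := 𝓡 n) (n := ∞) x) (fun y hy => by
    simpa using (extChartAt (𝓡 n) x).map_target hy)
  refine (contMDiffOn_iff_contDiffOn.1 h2).congr fun y hy => ?_
  have hs := (extChartAt (𝓡 n) x).map_target hy
  rw [extChartAt_source] at hs
  have h3 := TangentBundle.symmL_trivializationAt (I := 𝓡 n) hs
  rw [(extChartAt (𝓡 n) x).right_inv hy, (𝓡 n).range_eq_univ, mfderivWithin_univ] at h3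
  ext v
  have h4 := congrArg (fun A : EuclideanSpace ℝ (Fin n) →L[ℝ] EuclideanSpace ℝ (Fin n) =>
    (α ((extChartAt (𝓡 n) x).symm y)) (A v)) h3
  refine h4.symm.trans ?_
  rw [Function.comp_apply, hom_trivializationAt_apply]
  exact (congrArg (fun A : ℝ →L[ℝ] ℝ => A _)
    (Bundle.Trivial.continuousLinearMapAt_trivialization ℝ M ℝ _)).symm

lemma coordCovector_coordField (α : OneForm (𝓡 n) M) (V : VecField (𝓡 n) M) (x : M)
    {y : EuclideanSpace ℝ (Fin n)} (hy : y ∈ (extChartAt (𝓡 n) x).target) :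
    coordCovector α x y (coordField (𝓡 n) V x y)
      = α ((extChartAt (𝓡 n) x).symm y) (V ((extChartAt (𝓡 n) x).symm y)) := by
  have := mfderivWithin_coordField V x hy
  rw [(𝓡 n).range_eq_univ, mfderivWithin_univ] at this
  exact congrArg (α _) this

/-- `dα(X, Y) = X(α(Y)) - Y(α(X)) - α([X, Y])`. -/
theorem extD_apply {α : OneForm (𝓡 n) M} (hα : SmoothOneForm (𝓡 n) α) {X Y : VecField (𝓡 n) M}
    {x : M} (hX : DiffFieldAt (𝓡 n) X x) (hY : DiffFieldAt (𝓡 n) Y x) :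
    extD α x ![X x, Y x] = mvfderiv (𝓡 n) (fun y => α y (Y y)) x (X x)
      - mvfderiv (𝓡 n) (fun y => α y (X y)) x (Y x) - α x (mlieBracket (𝓡 n) X Y x) := by
  have hcov := (contDiffOn_coordCovector hα x).contDiffAt (extChartAt_target_mem_nhds x)
  have hd := hcov.differentiableAt (by simp)
  have hdX := differentiableAt_coordField hX
  have hdY := differentiableAt_coordField hY
  have hform : DifferentiableAt ℝ (coordForm α x) (extChartAt (𝓡 n) x x) :=
    (ContinuousAlternatingMap.ofSubsingletonLIE (0 : Fin 1) :
      (EuclideanSpace ℝ (Fin n) →L[ℝ] ℝ) ≃ₗᵢ[ℝ]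
        _).toContinuousLinearEquiv.differentiableAt.comp _ hd
  have key (U : VecField (𝓡 n) M) (hU : DiffFieldAt (𝓡 n) U x) (v : TangentSpace (𝓡 n) x) :
      mvfderiv (𝓡 n) (fun y => α y (U y)) x v
        = fderiv ℝ (fun y => coordCovector α x y (coordField (𝓡 n) U x y))
          (extChartAt (𝓡 n) x x) v := by
    have hev : (fun y => α y (U y)) =ᶠ[𝓝 x]
        (fun y => coordCovector α x y (coordField (𝓡 n) U x y)) ∘ extChartAt (𝓡 n) x := by
      filter_upwards [extChartAt_source_mem_nhds (I := 𝓡 n) x] with z hzs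
      have := coordCovector_coordField α U x ((extChartAt (𝓡 n) x).map_source hzs)
      rw [(extChartAt (𝓡 n) x).left_inv hzs] at this
      exact this.symm
    rw [mvfderiv_congr hev, mvfderiv_comp_extChartAt
      (hd.clm_apply (differentiableAt_coordField hU))]
  have h := extDeriv_apply_vectorField hform
    (V := ![coordField (𝓡 n) X x, coordField (𝓡 n) Y x])
    (by intro i; fin_cases i; exacts [hdX, hdY])
  have hXY : extD α x ![X x, Y x] = extDeriv (coordForm α x) (extChartAt (𝓡 n) x x)
      (fun i => (![coordField (𝓡 n) X x, coordField (𝓡 n) Y x] : Fin 2 → _) i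
        (extChartAt (𝓡 n) x x)) := by
    refine congrArg (extDeriv (coordForm α x) (extChartAt (𝓡 n) x x)) ?_
    funext i
    have hid := mfderiv_extChartAt_self (I := 𝓡 n) (x := x)
    fin_cases i
    · exact (congrArg (fun A : EuclideanSpace ℝ (Fin n) →L[ℝ] EuclideanSpace ℝ (Fin n) =>
        A (X x)) hid).trans (coordField_self X x).symm
    · exact (congrArg (fun A : EuclideanSpace ℝ (Fin n) →L[ℝ] EuclideanSpace ℝ (Fin n) =>
        A (Y x)) hid).trans (coordField_self Y x).symm
  have hlast : α x (mlieBracket (𝓡 n) X Y x) = coordCovector α x (extChartAt (𝓡 n) x x)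
      (lieBracket ℝ (coordField (𝓡 n) X x) (coordField (𝓡 n) Y x) (extChartAt (𝓡 n) x x)) := by
    have h0 := coordCovector_coordField α (mlieBracket (𝓡 n) X Y) x (mem_extChartAt_target x)
    rw [coordField_self, extChartAt_to_inv] at h0
    rw [← h0, mlieBracket_eq_lieBracket_coordField]
  rw [key X hX, key Y hY, hlast, hXY, h]
  have cX : coordField (𝓡 n) X x (chartAt _ x x) = X x := coordField_self X x
  have cY : coordField (𝓡 n) Y x (chartAt _ x x) = Y x := coordField_self Y x
  simp [Fin.sum_univ_succ, coordForm_eq]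
  rw [cX, cY]
  rfl

end ExteriorDerivative

section Restriction

variable {E : Type*} [NormedAddCommGroup E] [NormedSpace ℝ E] [FiniteDimensional ℝ E]
  {H : Type*} [TopologicalSpace H] {I : ModelWithCorners ℝ E H}
  {L : Type*} [TopologicalSpace L] [ChartedSpace H L]
  {E' : Type*} [NormedAddCommGroup E'] [NormedSpace ℝ E'] [FiniteDimensional ℝ E']
  {H' : Type*} [TopologicalSpace H'] {I' : ModelWithCorners ℝ E' H'}
  {M : Type*} [TopologicalSpace M] [ChartedSpace H' M]

lemma exists_contMDiffAt_leftInverse {B : L → (E →L[ℝ] E')} {x₀ : L}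
    (hB : ContMDiffAt I 𝓘(ℝ, E →L[ℝ] E') ∞ B x₀) (hinj : Function.Injective (B x₀)) :
    ∃ C : L → (E' →L[ℝ] E), ContMDiffAt I 𝓘(ℝ, E' →L[ℝ] E) ∞ C x₀ ∧
      ∀ᶠ x in 𝓝 x₀, (C x).comp (B x) = ContinuousLinearMap.id ℝ E := by
  have := FiniteDimensional.complete ℝ E
  obtain ⟨P, hP⟩ := (B x₀).toLinearMap.exists_leftInverse_of_injective
    (LinearMap.ker_eq_bot.2 hinj)
  set P' : E' →L[ℝ] E := LinearMap.toContinuousLinearMap P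
  have hP' : P'.comp (B x₀) = ContinuousLinearMap.id ℝ E := by
    ext v; exact congrArg (fun A : E →ₗ[ℝ] E => A v) hP
  have hK : ContMDiffAt I 𝓘(ℝ, E →L[ℝ] E) ∞ (fun x => P'.comp (B x)) x₀ :=
    contMDiffAt_const.clm_comp hB
  have hinv : (P'.comp (B x₀)).IsInvertible := by
    rw [hP']; exact ContinuousLinearMap.isInvertible_equiv (f := .refl ℝ E)
  have hev : ∀ᶠ x in 𝓝 x₀, (P'.comp (B x)).IsInvertible := by
    obtain ⟨e, he⟩ := hinv
    have h := ContinuousLinearEquiv.nhds e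
    rw [he] at h
    exact (hK.continuousAt.eventually h).mono fun x hx => hx
  refine ⟨fun x => (P'.comp (B x)).inverse.comp P', ?_, ?_⟩
  · refine ContMDiffAt.clm_comp ?_ contMDiffAt_const
    exact (hinv.contDiffAt_map_inverse).contMDiffAt.comp x₀ hK
  · filter_upwards [hev] with x hx
    rw [ContinuousLinearMap.comp_assoc]
    exact hx.inverse_comp_self

variable [IsManifold I ∞ L] [IsManifold I' ∞ M]

omit [FiniteDimensional ℝ E] [FiniteDimensional ℝ E'] in
lemma contMDiffAt_inTangentCoordinates_mfderiv {i : L → M} (hi : ContMDiff I I' ∞ i) (x₀ : L) :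
    ContMDiffAt I 𝓘(ℝ, E →L[ℝ] E') ∞ (fun x => ContinuousLinearMap.inCoordinates E
      (TangentSpace I : L → Type _) E' (TangentSpace I' : M → Type _) x₀ x (i x₀) (i x)
      (mfderiv I I' i x)) x₀ :=
  ContMDiffAt.mfderiv_const (hi x₀) (by norm_num)

omit [FiniteDimensional ℝ E] [FiniteDimensional ℝ E'] in
lemma eventually_mem_baseSet_comp {i : L → M} (hi : ContMDiff I I' ∞ i) (x₀ : L) :
    ∀ᶠ x in 𝓝 x₀, x ∈ (trivializationAt E (TangentSpace I : L → Type _) x₀).baseSet ∧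
      i x ∈ (trivializationAt E' (TangentSpace I' : M → Type _) (i x₀)).baseSet := by
  refine Filter.Eventually.and ?_ (hi.continuous.continuousAt.eventually ?_)
  · exact (trivializationAt E (TangentSpace I : L → Type _) x₀).open_baseSet.mem_nhds
      (FiberBundle.mem_baseSet_trivializationAt' x₀)
  · exact (trivializationAt E' (TangentSpace I' : M → Type _) (i x₀)).open_baseSet.mem_nhds
      (FiberBundle.mem_baseSet_trivializationAt' (i x₀))

lemma exists_contMDiffAt_leftInverse_mfderiv {i : L → M} (hi : ContMDiff I I' ∞ i)
    (hinj : ∀ x, Function.Injective (mfderiv I I' i x)) (x₀ : L) :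
    ∃ C : L → (E' →L[ℝ] E), ContMDiffAt I 𝓘(ℝ, E' →L[ℝ] E) ∞ C x₀ ∧
      ∀ᶠ x in 𝓝 x₀, (C x).comp (ContinuousLinearMap.inCoordinates E
      (TangentSpace I : L → Type _) E' (TangentSpace I' : M → Type _) x₀ x (i x₀) (i x)
      (mfderiv I I' i x)) = ContinuousLinearMap.id ℝ E := by
  refine exists_contMDiffAt_leftInverse (contMDiffAt_inTangentCoordinates_mfderiv hi x₀) ?_
  have h := (eventually_mem_baseSet_comp hi x₀).self_of_nhds
  rw [ContinuousLinearMap.inCoordinates_eq h.1 h.2]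
  intro a b hab
  exact ContinuousLinearEquiv.injective
    ((trivializationAt E (TangentSpace I : L → Type _) x₀).continuousLinearEquivAt ℝ x₀ h.1).symm
    (hinj x₀ (ContinuousLinearEquiv.injective ((trivializationAt E' (TangentSpace I' : M → Type _)
      (i x₀)).continuousLinearEquivAt ℝ (i x₀) h.2) hab))

/-- A vector field along an immersion which is tangent to it is smooth on the source. -/
theorem smoothVecField_of_mfderiv {i : L → M} (hi : ContMDiff I I' ∞ i)
    (hinj : ∀ x, Function.Injective (mfderiv I I' i x)) {u : VecField I L}
    (hu : ContMDiff I I'.tangent ∞ (fun x => (⟨i x, mfderiv I I' i x (u x)⟩ : TangentBundle I' M))) :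
    SmoothVecField I u := by
  intro x₀
  obtain ⟨C, hC, hCB⟩ := exists_contMDiffAt_leftInverse_mfderiv hi hinj x₀
  rw [Bundle.contMDiffAt_section]
  have h2 := (Bundle.contMDiffAt_totalSpace.1 (hu x₀)).2
  refine (hC.clm_apply h2).congr_of_eventuallyEq ?_
  filter_upwards [hCB, eventually_mem_baseSet_comp hi x₀] with x hx hb
  have h3 := congrArg (fun A : E →L[ℝ] E =>
    A (trivializationAt E (TangentSpace I : L → Type _) x₀ ⟨x, u x⟩).2) hx
  refine h3.symm.trans ?_
  rw [ContinuousLinearMap.inCoordinates_eq hb.1 hb.2]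
  refine congrArg (C x) ?_
  have h4 : ((trivializationAt E (TangentSpace I : L → Type _) x₀).continuousLinearEquivAt ℝ x
    hb.1).symm ((trivializationAt E (TangentSpace I : L → Type _) x₀ ⟨x, u x⟩).2) = u x :=
    ((trivializationAt E (TangentSpace I : L → Type _) x₀).continuousLinearEquivAt ℝ x
      hb.1).symm_apply_apply (u x)
  refine (congrArg (fun v => ((trivializationAt E' (TangentSpace I' : M → Type _)
    (i x₀)).continuousLinearEquivAt ℝ (i x) hb.2) (mfderiv I I' i x v)) h4).trans ?_
  rfl

theorem smoothEndoField_of_mfderiv {i : L → M} (hi : ContMDiff I I' ∞ i)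
    (hinj : ∀ x, Function.Injective (mfderiv I I' i x)) {φ : EndoField I' M}
    (hφ : SmoothEndoField I' φ) {ψ : EndoField I L}
    (hψ : ∀ x v, mfderiv I I' i x (ψ x v) = φ (i x) (mfderiv I I' i x v)) :
    SmoothEndoField I ψ := by
  intro x₀
  obtain ⟨C, hC, hCB⟩ := exists_contMDiffAt_leftInverse_mfderiv hi hinj x₀
  rw [contMDiffAt_hom_bundle]
  refine ⟨contMDiffAt_id, ?_⟩
  have h1 := ((contMDiffAt_hom_bundle _).1 (hφ (i x₀))).2.comp x₀ (hi x₀)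
  refine ((hC.clm_comp h1).clm_comp
    (contMDiffAt_inTangentCoordinates_mfderiv hi x₀)).congr_of_eventuallyEq ?_
  filter_upwards [hCB, eventually_mem_baseSet_comp hi x₀] with x hx hb
  have h3 := congrArg (fun A : E →L[ℝ] E => A.comp (ContinuousLinearMap.inCoordinates E
    (TangentSpace I : L → Type _) E (TangentSpace I : L → Type _) x₀ x x₀ x (ψ x))) hx
  refine h3.symm.trans ?_
  rw [ContinuousLinearMap.comp_assoc, ContinuousLinearMap.comp_assoc]
  refine congrArg (C x).comp ?_
  simp only [Function.comp]
  rw [ContinuousLinearMap.inCoordinates_eq hb.1 hb.2, ContinuousLinearMap.inCoordinates_eq hb.1 hb.1,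
    ContinuousLinearMap.inCoordinates_eq hb.2 hb.2]
  ext v
  set eL := (trivializationAt E (TangentSpace I : L → Type _) x₀).continuousLinearEquivAt ℝ x hb.1
  set eM := (trivializationAt E' (TangentSpace I' : M → Type _)
    (i x₀)).continuousLinearEquivAt ℝ (i x) hb.2
  exact ((congrArg (fun w => eM (mfderiv I I' i x w)) (eL.symm_apply_apply _)).trans
    (congrArg eM (hψ x (eL.symm v)))).trans
    (congrArg (fun w => eM (φ (i x) w)) (eM.symm_apply_apply _).symm)

omit [FiniteDimensional ℝ E] [FiniteDimensional ℝ E'] in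
theorem smoothOneForm_of_mfderiv {i : L → M} (hi : ContMDiff I I' ∞ i) {α : OneForm I' M}
    (hα : SmoothOneForm I' α) {β : OneForm I L}
    (hβ : ∀ x v, β x v = α (i x) (mfderiv I I' i x v)) : SmoothOneForm I β := by
  intro x₀
  rw [contMDiffAt_hom_bundle]
  refine ⟨contMDiffAt_id, ?_⟩
  have h1 := ((contMDiffAt_hom_bundle _).1 (hα (i x₀))).2.comp x₀ (hi x₀)
  refine (h1.clm_comp (contMDiffAt_inTangentCoordinates_mfderiv hi x₀)).congr_of_eventuallyEq ?_
  filter_upwards [eventually_mem_baseSet_comp hi x₀] with x hb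
  simp only [Function.comp]
  rw [ContinuousLinearMap.inCoordinates_eq hb.1 hb.2,
    ContinuousLinearMap.inCoordinates_eq hb.1 (F' := ℝ) (E' := fun _ : L => ℝ) (y₀ := x₀) (y := x)
      (mem_univ _),
    ContinuousLinearMap.inCoordinates_eq hb.2 (F' := ℝ) (E' := fun _ : M => ℝ) (y₀ := i x₀)
      (y := i x) (mem_univ _)]
  ext v
  set eL := (trivializationAt E (TangentSpace I : L → Type _) x₀).continuousLinearEquivAt ℝ x hb.1
  set eM := (trivializationAt E' (TangentSpace I' : M → Type _)
    (i x₀)).continuousLinearEquivAt ℝ (i x) hb.2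
  exact (hβ x (eL.symm v)).trans
    (congrArg (fun w => α (i x) w) (eM.symm_apply_apply _).symm)

end Restriction

section SmoothFields

variable {E : Type*} [NormedAddCommGroup E] [NormedSpace ℝ E]
  {H : Type*} [TopologicalSpace H] {I : ModelWithCorners ℝ E H}
  {M : Type*} [TopologicalSpace M] [ChartedSpace H M] [IsManifold I ∞ M]

lemma SmoothVecField.diffFieldAt {X : VecField I M} (hX : SmoothVecField I X) (x : M) :
    DiffFieldAt I X x :=
  (hX x).mdifferentiableAt (by simp)

lemma SmoothEndoField.apply {φ : EndoField I M} (hφ : SmoothEndoField I φ) {X : VecField I M}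
    (hX : SmoothVecField I X) : SmoothVecField I (fun x => φ x (X x)) :=
  ContMDiff.clm_bundle_apply (b := id) hφ hX

omit [IsManifold I ∞ M] in
lemma contMDiffAt_of_trivial_section {E' : Type*} [NormedAddCommGroup E'] [NormedSpace ℝ E']
    {H' : Type*} [TopologicalSpace H'] {I' : ModelWithCorners ℝ E' H'}
    {N : Type*} [TopologicalSpace N] [ChartedSpace H' N] {b : N → M} {f : N → ℝ} {x : N}
    (h : ContMDiffAt I' (I.prod 𝓘(ℝ, ℝ)) ∞
      (fun m ↦ Bundle.TotalSpace.mk' ℝ (E := fun _ : M => ℝ) (b m) (f m)) x) :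
    ContMDiffAt I' 𝓘(ℝ, ℝ) ∞ f x :=
  (Bundle.contMDiffAt_totalSpace.1 h).2

omit [IsManifold I ∞ M] in
lemma mdifferentiableAt_of_trivial_section {E' : Type*} [NormedAddCommGroup E'] [NormedSpace ℝ E']
    {H' : Type*} [TopologicalSpace H'] {I' : ModelWithCorners ℝ E' H'}
    {N : Type*} [TopologicalSpace N] [ChartedSpace H' N] {b : N → M} {f : N → ℝ} {x : N}
    (h : MDifferentiableAt I' (I.prod 𝓘(ℝ, ℝ))
      (fun m ↦ Bundle.TotalSpace.mk' ℝ (E := fun _ : M => ℝ) (b m) (f m)) x) :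
    MDifferentiableAt I' 𝓘(ℝ, ℝ) f x :=
  (mdifferentiableAt_totalSpace _ _ |>.1 h).2

lemma SmoothOneForm.apply {α : OneForm I M} (hα : SmoothOneForm I α) {X : VecField I M}
    (hX : SmoothVecField I X) : ContMDiff I 𝓘(ℝ, ℝ) ∞ (fun x => α x (X x)) := fun x =>
  contMDiffAt_of_trivial_section (I := I) (b := id)
    (ContMDiffAt.clm_bundle_apply (b := id) (E₂ := fun _ : M => ℝ) (hα x) (hX x))

lemma SmoothVecField.smul {f : M → ℝ} (hf : ContMDiff I 𝓘(ℝ, ℝ) ∞ f) {X : VecField I M}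
    (hX : SmoothVecField I X) : SmoothVecField I (fun x => f x • X x) :=
  ContMDiff.smul_section hf hX

lemma SmoothVecField.add {X Y : VecField I M} (hX : SmoothVecField I X)
    (hY : SmoothVecField I Y) : SmoothVecField I (fun x => X x + Y x) :=
  ContMDiff.add_section hX hY

lemma SmoothVecField.sub {X Y : VecField I M} (hX : SmoothVecField I X)
    (hY : SmoothVecField I Y) : SmoothVecField I (fun x => X x - Y x) :=
  ContMDiff.sub_section hX hY

lemma mdifferentiableAt_sub_smul_along {E' : Type*} [NormedAddCommGroup E'] [NormedSpace ℝ E']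
    {H' : Type*} [TopologicalSpace H'] {I' : ModelWithCorners ℝ E' H'}
    {N : Type*} [TopologicalSpace N] [ChartedSpace H' N] {b : N → M} {f : N → ℝ}
    {u w : Π q : N, TangentSpace I (b q)} {x : N}
    (hu : MDifferentiableAt I' I.tangent (fun q => (⟨b q, u q⟩ : TangentBundle I M)) x)
    (hw : MDifferentiableAt I' I.tangent (fun q => (⟨b q, w q⟩ : TangentBundle I M)) x)
    (hf : MDifferentiableAt I' 𝓘(ℝ, ℝ) f x) :
    MDifferentiableAt I' I.tangent (fun q => (⟨b q, u q - f q • w q⟩ : TangentBundle I M)) x := by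
  rw [mdifferentiableAt_totalSpace] at hu hw ⊢
  refine ⟨hu.1, (hu.2.sub (hf.smul hw.2)).congr_of_eventuallyEq ?_⟩
  filter_upwards [hu.1.continuousAt.eventually
    ((trivializationAt E (TangentSpace I : M → Type _) (b x)).open_baseSet.mem_nhds
      (FiberBundle.mem_baseSet_trivializationAt' (b x)))] with q hq
  have hlin := (trivializationAt E (TangentSpace I : M → Type _) (b x)).linear ℝ hq
  exact (hlin.map_sub (u q) (f q • w q)).trans (congrArg₂ (· - ·) rfl (hlin.map_smul (f q) (w q)))

/-- Every tangent vector extends to a global smooth vector field. -/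
theorem exists_smoothVecField_eq [FiniteDimensional ℝ E] [T2Space M] (x : M)
    (v : TangentSpace I x) : ∃ X : VecField I M, SmoothVecField I X ∧ X x = v := by
  obtain ⟨f⟩ : Nonempty (SmoothBumpFunction I x) := inferInstance
  set e := trivializationAt E (TangentSpace I : M → Type _) x
  have hx : x ∈ e.baseSet := FiberBundle.mem_baseSet_trivializationAt' x
  refine ⟨fun y => f y • e.symm y (e ⟨x, v⟩).2, ?_, ?_⟩
  · refine ContMDiffOn.smul_section_of_tsupport (ψ := f) (u := e.baseSet)
      (s := fun y => e.symm y (e ⟨x, v⟩).2) f.contMDiff.contMDiffOn e.open_baseSet ?_ ?_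
    · simpa [e] using f.tsupport_subset_chartAt_source
    · rw [Bundle.Trivialization.contMDiffOn_section_baseSet_iff e]
      refine (contMDiffOn_const (c := (e ⟨x, v⟩).2)).congr fun y hy => ?_
      exact (congrArg Prod.snd (e.apply_mk_symm hy (e ⟨x, v⟩).2) :)
  · have h1 : e.symm x (e ⟨x, v⟩).2 = v := e.symm_apply_apply_mk hx v
    change f x • e.symm x (e ⟨x, v⟩).2 = v
    rw [h1, f.eq_one, one_smul]

end SmoothFields

section ProdReal

variable {E : Type*} [NormedAddCommGroup E] [NormedSpace ℝ E]
  {H : Type*} [TopologicalSpace H] {I : ModelWithCorners ℝ E H}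
  {M : Type*} [TopologicalSpace M] [ChartedSpace H M] [IsManifold I ∞ M]

/-- The tangent vector `u + s ∂ₜ` of `M × ℝ`. -/
def pairVec (p : M × ℝ) (u : TangentSpace I p.1) (s : ℝ) : TangentSpace (I.prod 𝓘(ℝ, ℝ)) p :=
  ((u, s) : E × ℝ)

omit [IsManifold I ∞ M] in
lemma exists_eq_pairVec (p : M × ℝ) (w : TangentSpace (I.prod 𝓘(ℝ, ℝ)) p) :
    ∃ (u : TangentSpace I p.1) (s : ℝ), w = pairVec p u s :=
  ⟨(w : E × ℝ).1, (w : E × ℝ).2, rfl⟩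

lemma smoothVecField_pairVec {V : VecField I M} {a : M → ℝ} (hV : SmoothVecField I V)
    (ha : ContMDiff I 𝓘(ℝ, ℝ) ∞ a) :
    SmoothVecField (I.prod 𝓘(ℝ, ℝ)) (fun q : M × ℝ => pairVec q (V q.1) (a q.1)) := by
  have h1 := hV.comp (contMDiff_fst (I := I) (J := 𝓘(ℝ, ℝ)) (N := ℝ))
  have h2 : ContMDiff (I.prod 𝓘(ℝ, ℝ)) (𝓘(ℝ, ℝ)).tangent ∞
      (fun q : M × ℝ => (⟨q.2, a q.1⟩ : TangentBundle 𝓘(ℝ, ℝ) ℝ)) := by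
    intro q
    refine Bundle.contMDiffAt_totalSpace.2 ⟨contMDiffAt_snd, ?_⟩
    convert! (ha.comp contMDiff_fst) q with y
    simp
  exact (contMDiff_equivTangentBundleProd_symm (I := I) (I' := 𝓘(ℝ, ℝ)) (M := M) (M' := ℝ)).comp
    (h1.prodMk h2)

theorem mlieBracket_pairVec [FiniteDimensional ℝ E] [I.Boundaryless]
    {V W : VecField I M} {a b : M → ℝ} (hV : SmoothVecField I V) (hW : SmoothVecField I W)
    (ha : ContMDiff I 𝓘(ℝ, ℝ) ∞ a) (hb : ContMDiff I 𝓘(ℝ, ℝ) ∞ b) (p : M × ℝ) :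
    mlieBracket (I.prod 𝓘(ℝ, ℝ)) (fun q : M × ℝ => pairVec q (V q.1) (a q.1))
      (fun q : M × ℝ => pairVec q (W q.1) (b q.1)) p
    = pairVec p (mlieBracket I V W p.1) (mvfderiv I b p.1 (V p.1) - mvfderiv I a p.1 (W p.1)) :=
  have := FiniteDimensional.complete ℝ E
  mlieBracket_prod_real (hV.diffFieldAt p.1) (hW.diffFieldAt p.1)
    ((smoothVecField_pairVec hV ha).diffFieldAt p) ((smoothVecField_pairVec hW hb).diffFieldAt p)
    ((ha p.1).mdifferentiableAt (by simp)) ((hb p.1).mdifferentiableAt (by simp))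

lemma diffFieldAt_prod_real_iff {P : VecField (I.prod 𝓘(ℝ, ℝ)) (M × ℝ)} {p : M × ℝ} :
    DiffFieldAt (I.prod 𝓘(ℝ, ℝ)) P p ↔
      MDifferentiableAt (I.prod 𝓘(ℝ, ℝ)) I.tangent
        (fun q : M × ℝ => (⟨q.1, (P q : E × ℝ).1⟩ : TangentBundle I M)) p ∧
      MDifferentiableAt (I.prod 𝓘(ℝ, ℝ)) 𝓘(ℝ, ℝ) (fun q : M × ℝ => (P q : E × ℝ).2) p := by
  constructor
  · intro h
    have h1 := ((contMDiff_equivTangentBundleProd (I := I) (I' := 𝓘(ℝ, ℝ)) (M := M) (M' := ℝ)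
      (n := 1)) _).mdifferentiableAt (by simp) |>.comp p h
    have h2 := mdifferentiableAt_fst.comp p h1
    have h3 := mdifferentiableAt_snd.comp p h1
    exact ⟨h2, ((contMDiff_snd_tangentBundle_modelSpace ℝ 𝓘(ℝ, ℝ) (n := 1)) _).mdifferentiableAt
      (by simp) |>.comp p h3⟩
  · rintro ⟨h1, h2⟩
    have h3 : MDifferentiableAt (I.prod 𝓘(ℝ, ℝ)) (𝓘(ℝ, ℝ)).tangent
        (fun q : M × ℝ => (⟨q.2, (P q : E × ℝ).2⟩ : TangentBundle 𝓘(ℝ, ℝ) ℝ)) p := by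
      refine (mdifferentiableAt_totalSpace _ _).2 ⟨mdifferentiableAt_snd, ?_⟩
      convert! h2 with y
      simp
    exact ((contMDiff_equivTangentBundleProd_symm (I := I) (I' := 𝓘(ℝ, ℝ)) (M := M) (M' := ℝ)
      (n := 1)) _).mdifferentiableAt (by simp) |>.comp p (h1.prodMk h3)

end ProdReal

section AlmostContact

variable {d : ℕ} {N : Type*} [TopologicalSpace N]
  [ChartedSpace (EuclideanSpace ℝ (Fin d)) N] [IsManifold (𝓡 d) ∞ N]

lemma AlmostContactStructure.J_pairVec (A : AlmostContactStructure d N) (p : N × ℝ)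
    (u : TangentSpace (𝓡 d) p.1) (s : ℝ) :
    A.J p (pairVec p u s) = pairVec p (A.φ p.1 u - s • A.Z p.1) (A.α p.1 u) := rfl

lemma AlmostContactStructure.diffFieldAt_J (A : AlmostContactStructure d N)
    {P : VecField ((𝓡 d).prod 𝓘(ℝ, ℝ)) (N × ℝ)} {p : N × ℝ}
    (hP : DiffFieldAt ((𝓡 d).prod 𝓘(ℝ, ℝ)) P p) :
    DiffFieldAt ((𝓡 d).prod 𝓘(ℝ, ℝ)) (fun q => A.J q (P q)) p := by
  rw [diffFieldAt_prod_real_iff] at hP ⊢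
  obtain ⟨h1, h2⟩ := hP
  have hφ := ((A.smooth_φ p.1).mdifferentiableAt (by simp)).comp p
    (mdifferentiableAt_fst (I := 𝓡 d) (I' := 𝓘(ℝ, ℝ)) (M' := ℝ))
  have hα := ((A.smooth_α p.1).mdifferentiableAt (by simp)).comp p
    (mdifferentiableAt_fst (I := 𝓡 d) (I' := 𝓘(ℝ, ℝ)) (M' := ℝ))
  have hZ := ((A.smooth_Z p.1).mdifferentiableAt (by simp)).comp p
    (mdifferentiableAt_fst (I := 𝓡 d) (I' := 𝓘(ℝ, ℝ)) (M' := ℝ))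
  constructor
  · exact mdifferentiableAt_sub_smul_along
      (MDifferentiableAt.clm_bundle_apply (b := Prod.fst) hφ h1) hZ h2
  · exact mdifferentiableAt_of_trivial_section (I := 𝓡 d) (b := Prod.fst)
      (MDifferentiableAt.clm_bundle_apply (b := Prod.fst) (E₂ := fun _ : N => ℝ) hα h1)

end AlmostContact

section Leibniz

variable {E : Type*} [NormedAddCommGroup E] [NormedSpace ℝ E] [FiniteDimensional ℝ E]
  {H : Type*} [TopologicalSpace H] {I : ModelWithCorners ℝ E H}
  {M : Type*} [TopologicalSpace M] [ChartedSpace H M] [IsManifold I ∞ M]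
  {U V W : VecField I M} {f : M → ℝ}

lemma mlieBracket_fun_add_right (hV : SmoothVecField I V) (hW : SmoothVecField I W) (x : M) :
    mlieBracket I U (fun y => V y + W y) x = mlieBracket I U V x + mlieBracket I U W x :=
  have := FiniteDimensional.complete ℝ E
  mlieBracket_add_right (hV.diffFieldAt x) (hW.diffFieldAt x)

lemma mlieBracket_fun_smul_right (hf : ContMDiff I 𝓘(ℝ, ℝ) ∞ f) (hW : SmoothVecField I W) (x : M) :
    mlieBracket I V (fun y => f y • W y) x
      = mvfderiv I f x (V x) • W x + f x • mlieBracket I V W x :=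
  have := FiniteDimensional.complete ℝ E
  mlieBracket_smul_right ((hf x).mdifferentiableAt (by simp)) (hW.diffFieldAt x)

lemma mlieBracket_fun_sub_right (hV : SmoothVecField I V) (hW : SmoothVecField I W) (x : M) :
    mlieBracket I U (fun y => V y - W y) x = mlieBracket I U V x - mlieBracket I U W x := by
  have h1 := mlieBracket_fun_add_right (U := U) (hV.sub hW) hW x
  simp only [sub_add_cancel] at h1
  rw [h1, add_sub_cancel_right]

lemma mlieBracket_fun_smul_left (hf : ContMDiff I 𝓘(ℝ, ℝ) ∞ f) (hV : SmoothVecField I V) (x : M) :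
    mlieBracket I (fun y => f y • V y) W x
      = - (mvfderiv I f x (W x) • V x) + f x • mlieBracket I V W x := by
  rw [mlieBracket_swap_apply, mlieBracket_fun_smul_right hf hV,
    mlieBracket_swap_apply (V := W) (W := V), smul_neg]
  abel

lemma mlieBracket_fun_sub_left (hV : SmoothVecField I V) (hW : SmoothVecField I W) (x : M) :
    mlieBracket I (fun y => V y - W y) U x = mlieBracket I V U x - mlieBracket I W U x := by
  rw [mlieBracket_swap_apply, mlieBracket_fun_sub_right hV hW, mlieBracket_swap_apply (V := V),
    mlieBracket_swap_apply (V := W)]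
  abel

end Leibniz

section Transverse

variable {E : Type*} [NormedAddCommGroup E] [NormedSpace ℝ E]
  {H : Type*} [TopologicalSpace H] {I : ModelWithCorners ℝ E H}
  {M : Type*} [TopologicalSpace M] [ChartedSpace H M]

/-- The endomorphism field `φ - β ⊗ Z + α ⊗ ζ`. -/
def twist (α β : OneForm I M) (φ : EndoField I M) (Z ζ : VecField I M) : EndoField I M := fun x =>
  φ x - (β x).smulRight (Z x) + (α x).smulRight (ζ x)

/-- The bracket `[V, W] - β(V)[ζ, W] + β(W)[ζ, V]`. -/
def transverseBracket (β : OneForm I M) (ζ V W : VecField I M) : VecField I M := fun x =>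
  mlieBracket I V W x - β x (V x) • mlieBracket I ζ W x + β x (W x) • mlieBracket I ζ V x

/-- Two `1`-forms and two vector fields dual to each other, together with an `f`-structure `φ` with
complementary frame `Z`, `ζ`, all invariant under the flow of `ζ`. -/
structure IsInvariantFrame [IsManifold I ∞ M] (α β : OneForm I M) (φ : EndoField I M)
    (Z ζ : VecField I M) : Prop where
  smooth_α : SmoothOneForm I α
  smooth_β : SmoothOneForm I β
  smooth_φ : SmoothEndoField I φ
  smooth_Z : SmoothVecField I Z
  smooth_ζ : SmoothVecField I ζ
  α_Z : ∀ x, α x (Z x) = 1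
  β_ζ : ∀ x, β x (ζ x) = 1
  α_ζ : ∀ x, α x (ζ x) = 0
  β_Z : ∀ x, β x (Z x) = 0
  φ_sq : ∀ x v, φ x (φ x v) = -v + α x v • Z x + β x v • ζ x
  φ_Z : ∀ x, φ x (Z x) = 0
  φ_ζ : ∀ x, φ x (ζ x) = 0
  lie_α : ∀ X : VecField I M, SmoothVecField I X → ∀ x,
    α x (mlieBracket I ζ X x) = mvfderiv I (fun y => α y (X y)) x (ζ x)
  lie_β : ∀ X : VecField I M, SmoothVecField I X → ∀ x,
    β x (mlieBracket I ζ X x) = mvfderiv I (fun y => β y (X y)) x (ζ x)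
  lie_φ : ∀ X : VecField I M, SmoothVecField I X → ∀ x,
    mlieBracket I ζ (fun y => φ y (X y)) x = φ x (mlieBracket I ζ X x)

lemma twist_apply (α β : OneForm I M) (φ : EndoField I M) (Z ζ : VecField I M) (x : M)
    (v : TangentSpace I x) :
    twist α β φ Z ζ x v = φ x v - β x v • Z x + α x v • ζ x := rfl

namespace IsInvariantFrame

variable [IsManifold I ∞ M] {α β : OneForm I M} {φ : EndoField I M} {Z ζ : VecField I M}

lemma α_φ_and_β_φ (h : IsInvariantFrame α β φ Z ζ) (x : M) (v : TangentSpace I x) :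
    α x (φ x v) = 0 ∧ β x (φ x v) = 0 := by
  have h1 := h.φ_sq x (φ x v)
  rw [h.φ_sq x v, map_add, map_add, map_neg, map_smul, map_smul, h.φ_Z, h.φ_ζ, smul_zero,
    smul_zero, add_zero, add_zero, add_assoc, left_eq_add] at h1
  have h2 := congrArg (α x) h1
  have h3 := congrArg (β x) h1
  rw [map_add, map_smul, map_smul, h.α_Z, h.α_ζ, map_zero] at h2
  rw [map_add, map_smul, map_smul, h.β_Z, h.β_ζ, map_zero] at h3
  simpa using And.intro h2 h3

lemma smooth_twist (h : IsInvariantFrame α β φ Z ζ) {X : VecField I M}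
    (hX : SmoothVecField I X) : SmoothVecField I (fun x => twist α β φ Z ζ x (X x)) :=
  ((h.smooth_φ.apply hX).sub (h.smooth_Z.smul (h.smooth_β.apply hX))).add
    (h.smooth_ζ.smul (h.smooth_α.apply hX))

lemma mlieBracket_ζ_Z (h : IsInvariantFrame α β φ Z ζ) (x : M) : mlieBracket I ζ Z x = 0 := by
  have h1 := h.lie_φ Z h.smooth_Z x
  have h2 := h.lie_α Z h.smooth_Z x
  have h3 := h.lie_β Z h.smooth_Z x
  have hz : (fun y => φ y (Z y)) = 0 := funext h.φ_Z
  have hα : (fun y => α y (Z y)) = fun _ => 1 := funext h.α_Z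
  have hβ : (fun y => β y (Z y)) = fun _ => 0 := funext h.β_Z
  rw [hz, mlieBracket_zero_right] at h1
  rw [hα, mvfderiv_const] at h2
  rw [hβ, mvfderiv_const] at h3
  have h4 := h.φ_sq x (mlieBracket I ζ Z x)
  rw [← h1, h2, h3] at h4
  simpa using h4

variable [FiniteDimensional ℝ E]

/-- The endomorphism field `φ - β ⊗ Z + α ⊗ ζ` is invariant under the flow of `ζ`. -/
lemma lie_twist (h : IsInvariantFrame α β φ Z ζ) {X : VecField I M}
    (hX : SmoothVecField I X) (x : M) :
    mlieBracket I ζ (fun y => twist α β φ Z ζ y (X y)) x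
      = twist α β φ Z ζ x (mlieBracket I ζ X x) := by
  have h1 := h.smooth_φ.apply hX
  have h2 := h.smooth_Z.smul (h.smooth_β.apply hX)
  have h3 := h.smooth_ζ.smul (h.smooth_α.apply hX)
  refine (mlieBracket_fun_add_right (h1.sub h2) h3 x).trans ?_
  rw [mlieBracket_fun_sub_right h1 h2, mlieBracket_fun_smul_right (h.smooth_β.apply hX) h.smooth_Z,
    mlieBracket_fun_smul_right (h.smooth_α.apply hX) h.smooth_ζ, h.mlieBracket_ζ_Z,
    mlieBracket_self, h.lie_φ X hX, twist_apply, h.lie_α X hX, h.lie_β X hX]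
  simp

/-- The Nijenhuis tensor of `φ - β ⊗ Z + α ⊗ ζ` in terms of the transverse bracket. -/
theorem nijenhuis_twist (h : IsInvariantFrame α β φ Z ζ) {V W : VecField I M}
    (hV : SmoothVecField I V) (hW : SmoothVecField I W) (x : M) :
    nijenhuis I (twist α β φ Z ζ) V W x
      = transverseBracket β ζ (fun y => twist α β φ Z ζ y (V y))
          (fun y => twist α β φ Z ζ y (W y)) x
        - twist α β φ Z ζ x (transverseBracket β ζ (fun y => twist α β φ Z ζ y (V y)) W x)
        - twist α β φ Z ζ x (transverseBracket β ζ V (fun y => twist α β φ Z ζ y (W y)) x)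
        + twist α β φ Z ζ x (twist α β φ Z ζ x (transverseBracket β ζ V W x)) := by
  simp only [nijenhuis, transverseBracket, h.lie_twist hV, h.lie_twist hW, map_add, map_sub,
    map_smul]
  abel

/-- The transverse bracket through the bracket of the projections of the fields to `ker β`. -/
lemma mlieBracket_sub_smul (h : IsInvariantFrame α β φ Z ζ) {V W : VecField I M}
    (hV : SmoothVecField I V) (hW : SmoothVecField I W) (x : M) :
    mlieBracket I (fun y => V y - β y (V y) • ζ y) (fun y => W y - β y (W y) • ζ y) x
      + (mvfderiv I (fun y => β y (W y)) x (V x - β x (V x) • ζ x)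
          - mvfderiv I (fun y => β y (V y)) x (W x - β x (W x) • ζ x)) • ζ x
      = transverseBracket β ζ V W x := by
  have hb := h.smooth_β.apply hW
  have ha := h.smooth_β.apply hV
  rw [mlieBracket_fun_sub_right hW (h.smooth_ζ.smul hb), mlieBracket_fun_sub_left hV
    (h.smooth_ζ.smul ha), mlieBracket_fun_smul_right hb h.smooth_ζ, mlieBracket_fun_sub_left hV
    (h.smooth_ζ.smul ha), mlieBracket_fun_smul_left ha h.smooth_ζ,
    mlieBracket_fun_smul_left ha h.smooth_ζ, mlieBracket_self,
    mlieBracket_swap_apply (V := V) (W := ζ), transverseBracket]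
  simp only [map_sub, map_smul, smul_eq_mul, Pi.zero_apply]
  module

end IsInvariantFrame
end Transverse

section Suspension

variable {n d : ℕ} {M : Type*} [TopologicalSpace M] [ChartedSpace (EuclideanSpace ℝ (Fin n)) M]
  [IsManifold (𝓡 n) ∞ M] {L : Type*} [TopologicalSpace L]
  [ChartedSpace (EuclideanSpace ℝ (Fin d)) L] [IsManifold (𝓡 d) ∞ L]
  {α β : OneForm (𝓡 n) M} {φ : EndoField (𝓡 n) M} {Z ζ : VecField (𝓡 n) M} {i : L → M}

/-- The map `(u, s) ↦ di(u) + s ζ` from the tangent space of `L × ℝ` to that of `M`. -/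
def suspend (d : ℕ) [ChartedSpace (EuclideanSpace ℝ (Fin d)) L] (i : L → M)
    (ζ : VecField (𝓡 n) M) (p : L × ℝ) :
    TangentSpace ((𝓡 d).prod 𝓘(ℝ, ℝ)) p →L[ℝ] TangentSpace (𝓡 n) (i p.1) :=
  show (TangentSpace (𝓡 d) p.1 × ℝ) →L[ℝ] TangentSpace (𝓡 n) (i p.1) from
    (mfderiv (𝓡 d) (𝓡 n) i p.1).comp (ContinuousLinearMap.fst ℝ _ ℝ)
      + (ContinuousLinearMap.snd ℝ (TangentSpace (𝓡 d) p.1) ℝ).smulRight (ζ (i p.1))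

omit [IsManifold (𝓡 n) ∞ M] [IsManifold (𝓡 d) ∞ L] in
lemma suspend_apply (p : L × ℝ) (u : TangentSpace (𝓡 d) p.1) (s : ℝ) :
    suspend d i ζ p (pairVec p u s)
      = mfderiv (𝓡 d) (𝓡 n) i p.1 u + s • ζ (i p.1) := rfl

/-- A smooth map is an integral immersion of the kernel of `β`. -/
structure IsKernelImmersion (d : ℕ) [ChartedSpace (EuclideanSpace ℝ (Fin d)) L]
    (β : OneForm (𝓡 n) M) (i : L → M) : Prop where
  smooth : ContMDiff (𝓡 d) (𝓡 n) ∞ i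
  immersion : ∀ x, Function.Injective (mfderiv (𝓡 d) (𝓡 n) i x)
  mem_range : ∀ x v, v ∈ (mfderiv (𝓡 d) (𝓡 n) i x).range ↔ β (i x) v = 0

namespace IsKernelImmersion

omit [IsManifold (𝓡 n) ∞ M] [IsManifold (𝓡 d) ∞ L] in
lemma β_mfderiv (hi : IsKernelImmersion d β i) (x : L) (u : TangentSpace (𝓡 d) x) :
    β (i x) (mfderiv (𝓡 d) (𝓡 n) i x u) = 0 :=
  (hi.mem_range x _).1 ⟨u, rfl⟩

omit [IsManifold (𝓡 d) ∞ L] in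
lemma β_suspend (hi : IsKernelImmersion d β i) (h : IsInvariantFrame α β φ Z ζ) (p : L × ℝ)
    (u : TangentSpace (𝓡 d) p.1) (s : ℝ) :
    β (i p.1) (suspend d i ζ p (pairVec p u s)) = s := by
  rw [suspend_apply, map_add, map_smul, hi.β_mfderiv, h.β_ζ]
  simp

omit [IsManifold (𝓡 d) ∞ L] in
lemma suspend_injective (hi : IsKernelImmersion d β i) (h : IsInvariantFrame α β φ Z ζ)
    (p : L × ℝ) : Function.Injective (suspend d i ζ p) := by
  intro w w' huu
  obtain ⟨u, s, rfl⟩ := exists_eq_pairVec p w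
  obtain ⟨u', s', rfl⟩ := exists_eq_pairVec p w'
  have hs : s = s' := (hi.β_suspend h p u s).symm.trans
    ((congrArg (β (i p.1)) huu).trans (hi.β_suspend h p u' s'))
  subst hs
  have hu : u = u' := hi.immersion p.1 (add_right_cancel huu)
  rw [hu]

omit [IsManifold (𝓡 d) ∞ L] in
lemma exists_suspend_eq (hi : IsKernelImmersion d β i) (h : IsInvariantFrame α β φ Z ζ)
    (p : L × ℝ) (v : TangentSpace (𝓡 n) (i p.1)) : ∃ w, suspend d i ζ p w = v := by
  obtain ⟨u, hu⟩ := (hi.mem_range p.1 (v - β (i p.1) v • ζ (i p.1))).2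
    (by rw [map_sub, map_smul, h.β_ζ]; simp)
  refine ⟨pairVec p u (β (i p.1) v), ?_⟩
  rw [suspend_apply]
  exact (congrArg (· + β (i p.1) v • ζ (i p.1)) hu).trans (sub_add_cancel _ _)

omit [IsManifold (𝓡 d) ∞ L] in
lemma exists_lift (hi : IsKernelImmersion d β i) (h : IsInvariantFrame α β φ Z ζ)
    (V : VecField (𝓡 n) M) : ∃ P : VecField ((𝓡 d).prod 𝓘(ℝ, ℝ)) (L × ℝ),
      ∀ p, suspend d i ζ p (P p) = V (i p.1) := by
  choose P hP using fun p : L × ℝ => hi.exists_suspend_eq h p (V (i p.1))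
  exact ⟨P, hP⟩

omit [IsManifold (𝓡 d) ∞ L] in
lemma lift_eq (hi : IsKernelImmersion d β i) (h : IsInvariantFrame α β φ Z ζ)
    {V : VecField (𝓡 n) M} {P : VecField ((𝓡 d).prod 𝓘(ℝ, ℝ)) (L × ℝ)}
    (hP : ∀ p, suspend d i ζ p (P p) = V (i p.1)) :
    ∃ V' : VecField (𝓡 d) L,
      (∀ x, mfderiv (𝓡 d) (𝓡 n) i x (V' x) = V (i x) - β (i x) (V (i x)) • ζ (i x)) ∧
      P = fun p => pairVec p (V' p.1) (β (i p.1) (V (i p.1))) := by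
  choose u s hus using fun p => exists_eq_pairVec (I := 𝓡 d) p (P p)
  have h2 (p : L × ℝ) : s p = β (i p.1) (V (i p.1)) := by
    rw [← hP p, hus p, hi.β_suspend h]
  have h1 (p : L × ℝ) : P p = P (p.1, 0) :=
    hi.suspend_injective h p ((hP p).trans (hP (p.1, 0)).symm)
  refine ⟨fun x => u (x, 0), fun x => ?_, ?_⟩
  · have := hP (x, 0)
    rw [hus, suspend_apply, h2] at this
    exact eq_sub_of_add_eq this
  · funext p
    refine ((h1 p).trans (hus (p.1, 0))).trans ?_
    rw [h2]
    rfl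

lemma lift_smooth (hi : IsKernelImmersion d β i) (h : IsInvariantFrame α β φ Z ζ)
    {V : VecField (𝓡 n) M} (hV : SmoothVecField (𝓡 n) V) {V' : VecField (𝓡 d) L}
    (hV' : ∀ x, mfderiv (𝓡 d) (𝓡 n) i x (V' x) = V (i x) - β (i x) (V (i x)) • ζ (i x)) :
    SmoothVecField (𝓡 d) V' := by
  refine smoothVecField_of_mfderiv hi.smooth hi.immersion ?_
  simp only [hV']
  exact (hV.sub (h.smooth_ζ.smul (h.smooth_β.apply hV))).comp hi.smooth

lemma lift_smoothVecField (hi : IsKernelImmersion d β i) (h : IsInvariantFrame α β φ Z ζ)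
    {V : VecField (𝓡 n) M} (hV : SmoothVecField (𝓡 n) V)
    {P : VecField ((𝓡 d).prod 𝓘(ℝ, ℝ)) (L × ℝ)}
    (hP : ∀ p, suspend d i ζ p (P p) = V (i p.1)) :
    SmoothVecField ((𝓡 d).prod 𝓘(ℝ, ℝ)) P := by
  obtain ⟨V', hV', rfl⟩ := hi.lift_eq h hP
  exact smoothVecField_pairVec (hi.lift_smooth h hV hV') ((h.smooth_β.apply hV).comp hi.smooth)

/-- The bracket of the lifts to `L × ℝ` lifts the transverse bracket. -/
theorem suspend_mlieBracket (hi : IsKernelImmersion d β i) (h : IsInvariantFrame α β φ Z ζ)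
    {V W : VecField (𝓡 n) M} (hV : SmoothVecField (𝓡 n) V) (hW : SmoothVecField (𝓡 n) W)
    {P Q : VecField ((𝓡 d).prod 𝓘(ℝ, ℝ)) (L × ℝ)}
    (hP : ∀ p, suspend d i ζ p (P p) = V (i p.1))
    (hQ : ∀ p, suspend d i ζ p (Q p) = W (i p.1)) (p : L × ℝ) :
    suspend d i ζ p (mlieBracket ((𝓡 d).prod 𝓘(ℝ, ℝ)) P Q p)
      = transverseBracket β ζ V W (i p.1) := by
  obtain ⟨V', hV', rfl⟩ := hi.lift_eq h hP
  obtain ⟨W', hW', rfl⟩ := hi.lift_eq h hQ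
  have sV := hi.lift_smooth h hV hV'
  have sW := hi.lift_smooth h hW hW'
  have hb := h.smooth_β.apply hW
  have ha := h.smooth_β.apply hV
  rw [mlieBracket_pairVec (a := fun x => β (i x) (V (i x))) (b := fun x => β (i x) (W (i x)))
    sV sW (ha.comp hi.smooth) (hb.comp hi.smooth), suspend_apply]
  have hdi := (hi.smooth p.1).mdifferentiableAt (n := ∞) (by simp)
  rw [mvfderiv_comp_apply' (f := i) ((hb _).mdifferentiableAt (by simp)) hdi,
    mvfderiv_comp_apply' (f := i) ((ha _).mdifferentiableAt (by simp)) hdi, hV', hW',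
    mfderiv_mlieBracket_of_related (f := i)
      (V' := fun y => V y - β y (V y) • ζ y) (W' := fun y => W y - β y (W y) • ζ y)
      ((hi.smooth p.1).of_le (by norm_cast)) (sV.diffFieldAt p.1)
      (sW.diffFieldAt p.1)
      ((hV.sub (h.smooth_ζ.smul ha)).diffFieldAt _) ((hW.sub (h.smooth_ζ.smul hb)).diffFieldAt _)
      hV' hW']
  exact h.mlieBracket_sub_smul hV hW (i p.1)

variable {A : AlmostContactStructure d L}

/-- The almost complex structure on `L × ℝ` corresponds to `φ - β ⊗ Z + α ⊗ ζ`. -/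
lemma suspend_J (hi : IsKernelImmersion d β i) (h : IsInvariantFrame α β φ Z ζ)
    (hα : ∀ x v, A.α x v = α (i x) (mfderiv (𝓡 d) (𝓡 n) i x v))
    (hZ : ∀ x, mfderiv (𝓡 d) (𝓡 n) i x (A.Z x) = Z (i x))
    (hφ : ∀ x v, mfderiv (𝓡 d) (𝓡 n) i x (A.φ x v) = φ (i x) (mfderiv (𝓡 d) (𝓡 n) i x v))
    (p : L × ℝ) (w : TangentSpace ((𝓡 d).prod 𝓘(ℝ, ℝ)) p) :
    suspend d i ζ p (A.J p w) = twist α β φ Z ζ (i p.1) (suspend d i ζ p w) := by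
  obtain ⟨u, s, rfl⟩ := exists_eq_pairVec p w
  rw [twist_apply, hi.β_suspend h, A.J_pairVec, suspend_apply, suspend_apply]
  simp only [map_add, map_smul, h.φ_ζ, h.α_ζ, hα]
  have h1 : mfderiv (𝓡 d) (𝓡 n) i p.1 (A.φ p.1 u - s • A.Z p.1)
      = φ (i p.1) (mfderiv (𝓡 d) (𝓡 n) i p.1 u) - s • Z (i p.1) := by
    rw [← hφ, ← hZ]
    exact (map_sub _ _ _).trans (congrArg _ (map_smul _ _ _))
  refine (congrArg (· + _) h1).trans ?_
  module

/-- The Nijenhuis tensor of the structure on `L × ℝ` lifts that of `φ - β ⊗ Z + α ⊗ ζ`. -/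
theorem suspend_nijenhuis (hi : IsKernelImmersion d β i) (h : IsInvariantFrame α β φ Z ζ)
    (hα : ∀ x v, A.α x v = α (i x) (mfderiv (𝓡 d) (𝓡 n) i x v))
    (hZ : ∀ x, mfderiv (𝓡 d) (𝓡 n) i x (A.Z x) = Z (i x))
    (hφ : ∀ x v, mfderiv (𝓡 d) (𝓡 n) i x (A.φ x v) = φ (i x) (mfderiv (𝓡 d) (𝓡 n) i x v))
    {V W : VecField (𝓡 n) M} (hV : SmoothVecField (𝓡 n) V) (hW : SmoothVecField (𝓡 n) W)
    {P Q : VecField ((𝓡 d).prod 𝓘(ℝ, ℝ)) (L × ℝ)}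
    (hP : ∀ p, suspend d i ζ p (P p) = V (i p.1))
    (hQ : ∀ p, suspend d i ζ p (Q p) = W (i p.1)) (p : L × ℝ) :
    suspend d i ζ p (nijenhuis ((𝓡 d).prod 𝓘(ℝ, ℝ)) A.J P Q p)
      = nijenhuis (𝓡 n) (twist α β φ Z ζ) V W (i p.1) := by
  have hJ (w) := hi.suspend_J h hα hZ hφ p w
  have hJP (q : L × ℝ) : suspend d i ζ q (A.J q (P q)) = twist α β φ Z ζ (i q.1) (V (i q.1)) := by
    rw [hi.suspend_J h hα hZ hφ, hP]
  have hJQ (q : L × ℝ) : suspend d i ζ q (A.J q (Q q)) = twist α β φ Z ζ (i q.1) (W (i q.1)) := by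
    rw [hi.suspend_J h hα hZ hφ, hQ]
  have sV := h.smooth_twist hV
  have sW := h.smooth_twist hW
  rw [h.nijenhuis_twist hV hW, nijenhuis, map_add, map_sub, map_sub, hJ, hJ, hJ, hJ,
    hi.suspend_mlieBracket h sV sW hJP hJQ, hi.suspend_mlieBracket h sV hW hJP hQ,
    hi.suspend_mlieBracket h hV sW hP hJQ, hi.suspend_mlieBracket h hV hW hP hQ]

/-- If `φ - β ⊗ Z + α ⊗ ζ` is integrable, the induced almost contact structure is normal. -/
theorem isNormal_of_nijenhuisVanishes [T2Space M] (hi : IsKernelImmersion d β i)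
    (h : IsInvariantFrame α β φ Z ζ)
    (hα : ∀ x v, A.α x v = α (i x) (mfderiv (𝓡 d) (𝓡 n) i x v))
    (hZ : ∀ x, mfderiv (𝓡 d) (𝓡 n) i x (A.Z x) = Z (i x))
    (hφ : ∀ x v, mfderiv (𝓡 d) (𝓡 n) i x (A.φ x v) = φ (i x) (mfderiv (𝓡 d) (𝓡 n) i x v))
    (hN : NijenhuisVanishes (𝓡 n) (twist α β φ Z ζ)) : A.IsNormal := by
  intro X Y hX hY p
  obtain ⟨V, hV, hVp⟩ := exists_smoothVecField_eq (I := 𝓡 n) (i p.1) (suspend d i ζ p (X p))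
  obtain ⟨W, hW, hWp⟩ := exists_smoothVecField_eq (I := 𝓡 n) (i p.1) (suspend d i ζ p (Y p))
  obtain ⟨P, hP⟩ := hi.exists_lift h V
  obtain ⟨Q, hQ⟩ := hi.exists_lift h W
  rw [nijenhuis_congr_of_eq (fun P hP => A.diffFieldAt_J hP) (hX.diffFieldAt p)
    ((hi.lift_smoothVecField h hV hP).diffFieldAt p) (hY.diffFieldAt p) ((hi.lift_smoothVecField h hW hQ).diffFieldAt p)
    (hi.suspend_injective h p (hVp.symm.trans (hP p).symm))
    (hi.suspend_injective h p (hWp.symm.trans (hQ p).symm))]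
  refine hi.suspend_injective h p ?_
  rw [hi.suspend_nijenhuis h hα hZ hφ hV hW hP hQ, hN V W hV hW, map_zero]

/-- If the induced almost contact structure on `L` is normal, `φ - β ⊗ Z + α ⊗ ζ` is integrable
along the image of `L`. -/
theorem nijenhuis_eq_zero_of_isNormal (hi : IsKernelImmersion d β i)
    (h : IsInvariantFrame α β φ Z ζ)
    (hα : ∀ x v, A.α x v = α (i x) (mfderiv (𝓡 d) (𝓡 n) i x v))
    (hZ : ∀ x, mfderiv (𝓡 d) (𝓡 n) i x (A.Z x) = Z (i x))
    (hφ : ∀ x v, mfderiv (𝓡 d) (𝓡 n) i x (A.φ x v) = φ (i x) (mfderiv (𝓡 d) (𝓡 n) i x v))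
    (hA : A.IsNormal) {V W : VecField (𝓡 n) M} (hV : SmoothVecField (𝓡 n) V)
    (hW : SmoothVecField (𝓡 n) W) (x : L) :
    nijenhuis (𝓡 n) (twist α β φ Z ζ) V W (i x) = 0 := by
  obtain ⟨P, hP⟩ := hi.exists_lift h V
  obtain ⟨Q, hQ⟩ := hi.exists_lift h W
  rw [← hi.suspend_nijenhuis h hα hZ hφ hV hW hP hQ (x, 0),
    hA P Q (hi.lift_smoothVecField h hV hP) (hi.lift_smoothVecField h hW hQ), map_zero]

end IsKernelImmersion

end Suspension

section WedgePower

variable {V : Type*} [AddCommGroup V] [Module ℝ V]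

lemma wedge_constOfIsEmpty_apply (w : V [⋀^Fin 2]→ₗ[ℝ] ℝ) (v : Fin (0 + 2) → V) :
    wedge (AlternatingMap.constOfIsEmpty ℝ V (Fin 0) (1 : ℝ)) w v
      = w (fun j => v (Fin.natAdd 0 j)) := by
  have hsub : Subsingleton (Equiv.Perm.ModSumCongr (Fin 0) (Fin 2)) := by
    refine ⟨fun a b => ?_⟩
    induction a using Quotient.inductionOn' with | _ σ
    induction b using Quotient.inductionOn' with | _ τ
    refine Quotient.sound' (QuotientGroup.leftRel_apply.2
      (Equiv.Perm.mem_sumCongrHom_range_of_perm_mapsTo_inl ?_))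
    rintro _ ⟨j, -⟩
    exact Fin.elim0 j
  have h2 (u : Fin 0 ⊕ Fin 2 → V) :
      (AlternatingMap.domCoprod (AlternatingMap.constOfIsEmpty ℝ V (Fin 0) (1 : ℝ)) w) u
        = (1 : ℝ) ⊗ₜ[ℝ] w (fun j => u (Sum.inr j)) := by
    rw [AlternatingMap.domCoprod_apply, sum_apply]
    refine (Fintype.sum_subsingleton _ (Quotient.mk'' 1)).trans ?_
    rw [AlternatingMap.domCoprod.summand_mk'']
    simp
  refine (congrArg (LinearMap.mul' ℝ ℝ) (h2 (v ∘ finSumFinEquiv))).trans ?_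
  rw [LinearMap.mul'_apply, one_mul]
  rfl

/-- The first wedge power of a form vanishes only if the form does. -/
lemma eq_zero_of_wedgePow_one_eq_zero {w : V [⋀^Fin 2]→ₗ[ℝ] ℝ} (h : wedgePow w (0 + 1) = 0) :
    w = 0 := by
  ext v
  have h1 := wedge_constOfIsEmpty_apply w (fun j => v (Fin.cast (zero_add 2) j))
  have h2 : wedge (AlternatingMap.constOfIsEmpty ℝ V (Fin 0) (1 : ℝ)) w = 0 := h
  rw [h2] at h1
  refine Eq.trans (congrArg w ?_) h1.symm
  funext j
  exact congrArg v (Fin.ext (by simp))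

end WedgePower

section Frame

variable {n : ℕ} {M : Type*} [TopologicalSpace M] [ChartedSpace (EuclideanSpace ℝ (Fin n)) M]
  [IsManifold (𝓡 n) ∞ M]

lemma SmoothVecField.neg {X : VecField (𝓡 n) M} (hX : SmoothVecField (𝓡 n) X) :
    SmoothVecField (𝓡 n) (fun x => - X x) :=
  ContMDiff.neg_section hX

/-- If `Z` contracts `dα` to zero and `α(Z)` is constant, then `α` is invariant under the flow
of `Z`. -/
lemma apply_mlieBracket_of_contraction {α : OneForm (𝓡 n) M} (hα : SmoothOneForm (𝓡 n) α)
    {Z X : VecField (𝓡 n) M} (hZ : SmoothVecField (𝓡 n) Z) (hX : SmoothVecField (𝓡 n) X) {c : ℝ}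
    (hc : ∀ x, α x (Z x) = c) (hd : ∀ x v, extD α x ![Z x, v] = 0) (x : M) :
    α x (mlieBracket (𝓡 n) Z X x) = mvfderiv (𝓡 n) (fun y => α y (X y)) x (Z x) := by
  have h := extD_apply hα (hZ.diffFieldAt x) (hX.diffFieldAt x)
  have hz : (fun y => α y (Z y)) = fun _ => c := funext hc
  rw [hd, hz, mvfderiv_const] at h
  simp only [zero_apply, sub_zero] at h
  linarith

namespace ContactPairStructure

variable {h k : ℕ}

lemma isInvariantFrame (S : ContactPairStructure n h k M)
    (hL : LieDerivEndoVanishes (𝓡 n) S.Z₂ S.φ) :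
    IsInvariantFrame S.α₁ S.α₂ S.φ S.Z₁ S.Z₂ where
  smooth_α := S.isContactPair.smooth₁
  smooth_β := S.isContactPair.smooth₂
  smooth_φ := S.smooth_φ
  smooth_Z := S.isReebPair.smooth₁
  smooth_ζ := S.isReebPair.smooth₂
  α_Z := S.isReebPair.pairing₁₁
  β_ζ := S.isReebPair.pairing₂₂
  α_ζ := S.isReebPair.pairing₁₂
  β_Z := S.isReebPair.pairing₂₁
  φ_sq := S.φ_sq
  φ_Z := S.φ_Z₁
  φ_ζ := S.φ_Z₂
  lie_α _ hX := apply_mlieBracket_of_contraction S.isContactPair.smooth₁ S.isReebPair.smooth₂ hX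
    S.isReebPair.pairing₁₂ S.isReebPair.contraction₂₁
  lie_β _ hX := apply_mlieBracket_of_contraction S.isContactPair.smooth₂ S.isReebPair.smooth₂ hX
    S.isReebPair.pairing₂₂ S.isReebPair.contraction₂₂
  lie_φ X hX x := sub_eq_zero.1 (hL X hX x)

end ContactPairStructure

/-- Reversing the signs of `β` and `ζ` preserves invariant frames. -/
lemma IsInvariantFrame.neg {α β : OneForm (𝓡 n) M} {φ : EndoField (𝓡 n) M}
    {Z ζ : VecField (𝓡 n) M} (h : IsInvariantFrame α β φ Z ζ) :
    IsInvariantFrame α (fun x => - β x) φ Z (fun x => - ζ x) := by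
  have hneg (X : VecField (𝓡 n) M) (x : M) :
      mlieBracket (𝓡 n) (fun y => - ζ y) X x = - mlieBracket (𝓡 n) ζ X x := by
    have h1 := mlieBracket_fun_smul_left (f := fun _ => (-1 : ℝ)) (W := X) contMDiff_const
      h.smooth_ζ x
    rw [mvfderiv_const] at h1
    simpa using h1
  exact {
    smooth_α := h.smooth_α
    smooth_β := ContMDiff.neg_section h.smooth_β
    smooth_φ := h.smooth_φ
    smooth_Z := h.smooth_Z
    smooth_ζ := h.smooth_ζ.neg
    α_Z := h.α_Z
    β_ζ := fun x => by simp [h.β_ζ]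
    α_ζ := fun x => by simp [h.α_ζ]
    β_Z := fun x => by simp [h.β_Z]
    φ_sq := fun x v => by simp [h.φ_sq]
    φ_Z := h.φ_Z
    φ_ζ := fun x => by simp [h.φ_ζ]
    lie_α := fun X hX x => by rw [hneg, map_neg, map_neg, h.lie_α X hX]
    lie_β := fun X hX x => by
      have h1 := h.lie_β X hX x
      have h2 : mvfderiv (𝓡 n) (fun y => (- β y) (X y)) x = - mvfderiv (𝓡 n) (fun y => β y (X y)) x :=
        mfderiv_neg
      rw [hneg, h2, map_neg, map_neg]
      simpa using h1
    lie_φ := fun X hX x => by rw [hneg, hneg, h.lie_φ X hX, map_neg] }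

omit [IsManifold (𝓡 n) ∞ M] in
lemma twist_neg (α β : OneForm (𝓡 n) M) (φ : EndoField (𝓡 n) M) (Z ζ : VecField (𝓡 n) M) :
    twist α (fun x => - β x) φ Z (fun x => - ζ x)
      = fun x => φ x + (β x).smulRight (Z x) - (α x).smulRight (ζ x) := by
  funext x
  ext v
  simp [twist, sub_eq_add_neg]

lemma ContactPairStructure.T_eq_twist {h k : ℕ} (S : ContactPairStructure n h k M) :
    S.T = twist S.α₁ (fun x => - S.α₂ x) S.φ S.Z₁ (fun x => - S.Z₂ x) :=
  (twist_neg _ _ _ _ _).symm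

lemma mem_charDistribution_iff {h : ℕ} (S : ContactPairStructure n h 0 M) (x : M)
    (v : TangentSpace (𝓡 n) x) : v ∈ charDistribution S.α₂ x ↔ S.α₂ x v = 0 := by
  refine ⟨fun hv => hv.1, fun hv => ⟨hv, fun w => ?_⟩⟩
  exact congrArg (fun f => f ![v, w])
    (eq_zero_of_wedgePow_one_eq_zero (S.isContactPair.power₂ x))

lemma extD_α₂_eq_zero {h : ℕ} (S : ContactPairStructure n h 0 M) (x : M)
    (v w : TangentSpace (𝓡 n) x) : extD S.α₂ x ![v, w] = 0 :=
  congrArg (fun f => f ![v, w]) (eq_zero_of_wedgePow_one_eq_zero (S.isContactPair.power₂ x))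

variable {d : ℕ} {L : Type*} [TopologicalSpace L]
  [ChartedSpace (EuclideanSpace ℝ (Fin d)) L] [IsManifold (𝓡 d) ∞ L]

omit [IsManifold (𝓡 n) ∞ M] [IsManifold (𝓡 d) ∞ L] in
lemma IsKernelImmersion.neg {β : OneForm (𝓡 n) M} {i : L → M} (hi : IsKernelImmersion d β i) :
    IsKernelImmersion d (fun x => - β x) i where
  smooth := hi.smooth
  immersion := hi.immersion
  mem_range x v := by simp [← hi.mem_range]

/-- The almost contact structure induced on an immersed integral manifold of `ker β`. -/
theorem IsKernelImmersion.exists_induced {α β : OneForm (𝓡 n) M} {φ : EndoField (𝓡 n) M}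
    {Z ζ : VecField (𝓡 n) M} {i : L → M} (hi : IsKernelImmersion d β i)
    (h : IsInvariantFrame α β φ Z ζ) : ∃ A : AlmostContactStructure d L,
      (∀ x v, A.α x v = α (i x) (mfderiv (𝓡 d) (𝓡 n) i x v)) ∧
      (∀ x, mfderiv (𝓡 d) (𝓡 n) i x (A.Z x) = Z (i x)) ∧
      (∀ x v, mfderiv (𝓡 d) (𝓡 n) i x (A.φ x v) = φ (i x) (mfderiv (𝓡 d) (𝓡 n) i x v)) := by
  choose Z' hZ' using fun x => (hi.mem_range x (Z (i x))).2 (h.β_Z _)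
  have hr (x : L) (v : TangentSpace (𝓡 d) x) : ∃ u : TangentSpace (𝓡 d) x,
      mfderiv (𝓡 d) (𝓡 n) i x u = φ (i x) (mfderiv (𝓡 d) (𝓡 n) i x v) :=
    (hi.mem_range x _).2 (h.α_φ_and_β_φ _ _).2
  choose ψ hψ using hr
  have hadd (x : L) (u v : TangentSpace (𝓡 d) x) : ψ x (u + v) = ψ x u + ψ x v :=
    hi.immersion x (by rw [hψ, map_add, map_add, map_add, hψ, hψ])
  have hsmul (x : L) (c : ℝ) (v : TangentSpace (𝓡 d) x) : ψ x (c • v) = c • ψ x v :=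
    hi.immersion x (by rw [hψ, map_smul, map_smul, map_smul, hψ])
  let φ' : EndoField (𝓡 d) L := fun x =>
    (LinearMap.toContinuousLinearMap ⟨⟨fun v : EuclideanSpace ℝ (Fin d) => ψ x v, hadd x⟩, hsmul x⟩ :
      EuclideanSpace ℝ (Fin d) →L[ℝ] EuclideanSpace ℝ (Fin d))
  have hφ' (x : L) (v : TangentSpace (𝓡 d) x) : mfderiv (𝓡 d) (𝓡 n) i x (φ' x v)
    = φ (i x) (mfderiv (𝓡 d) (𝓡 n) i x v) := hψ x v
  let α' : OneForm (𝓡 d) L := fun x => (α (i x)).comp (mfderiv (𝓡 d) (𝓡 n) i x)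
  have hα' (x : L) (v : TangentSpace (𝓡 d) x) :
    α' x v = α (i x) (mfderiv (𝓡 d) (𝓡 n) i x v) := rfl
  have hZ'' (x : L) : mfderiv (𝓡 d) (𝓡 n) i x (Z' x) = Z (i x) := hZ' x
  refine ⟨{
    α := α'
    Z := Z'
    φ := φ'
    smooth_α := smoothOneForm_of_mfderiv hi.smooth h.smooth_α hα'
    smooth_Z := smoothVecField_of_mfderiv hi.smooth hi.immersion ?_
    smooth_φ := smoothEndoField_of_mfderiv hi.smooth hi.immersion h.smooth_φ hφ'
    φ_sq := fun x v => hi.immersion x ?_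
    φ_Z := fun x => hi.immersion x ?_
    α_Z := fun x => ?_ }, hα', hZ'', hφ'⟩
  · simp only [hZ'']
    exact h.smooth_Z.comp hi.smooth
  · rw [hφ', hφ', h.φ_sq, map_add, map_neg, map_smul, hZ'', hα', hi.β_mfderiv]
    simp
  · rw [hφ', hZ'', h.φ_Z, map_zero]
  · rw [hα', hZ'', h.α_Z]

end Frame

section Primitive

variable {n : ℕ} {M : Type*} [TopologicalSpace M] [ChartedSpace (EuclideanSpace ℝ (Fin n)) M]
  [IsManifold (𝓡 n) ∞ M]

/-- The coordinate vector fields of a chart. -/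
lemma exists_coordinate_field (p : M) (u : EuclideanSpace ℝ (Fin n)) : ∃ X : VecField (𝓡 n) M,
    (∀ z ∈ (extChartAt (𝓡 n) p).source, DiffFieldAt (𝓡 n) X z) ∧
    (∀ z ∈ (extChartAt (𝓡 n) p).source, mvfderiv (𝓡 n) (extChartAt (𝓡 n) p) z (X z) = u) ∧
    (∀ (α : OneForm (𝓡 n) M), ∀ z ∈ (extChartAt (𝓡 n) p).source,
      α z (X z) = coordCovector α p (extChartAt (𝓡 n) p z) u) := by
  set e := trivializationAt (EuclideanSpace ℝ (Fin n)) (TangentSpace (𝓡 n) : M → Type _) p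
  have hs (z : M) (hz : z ∈ (extChartAt (𝓡 n) p).source) :
      (e.symmL ℝ z : EuclideanSpace ℝ (Fin n) →L[ℝ] EuclideanSpace ℝ (Fin n))
      = mfderiv 𝓘(ℝ, EuclideanSpace ℝ (Fin n)) (𝓡 n) (extChartAt (𝓡 n) p).symm
        (extChartAt (𝓡 n) p z) := by
    rw [extChartAt_source] at hz
    have h3 := TangentBundle.symmL_trivializationAt (I := 𝓡 n) hz
    rw [(𝓡 n).range_eq_univ, mfderivWithin_univ] at h3
    exact h3
  refine ⟨fun z => e.symmL ℝ z u, fun z hz => ?_, fun z hz => ?_, fun α z hz => ?_⟩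
  · have h : ContMDiffOn (𝓡 n) (𝓡 n).tangent ∞
        (fun z => (⟨z, e.symmL ℝ z u⟩ : TangentBundle (𝓡 n) M)) e.baseSet := by
      rw [Bundle.Trivialization.contMDiffOn_section_baseSet_iff e]
      refine (contMDiffOn_const (c := u)).congr fun y hy => ?_
      rw [Bundle.Trivialization.symmL_apply]
      · exact (congrArg Prod.snd (e.apply_mk_symm hy u) :)
      · exact hy
    have hb : e.baseSet ∈ 𝓝 z := e.open_baseSet.mem_nhds (by simpa [e] using hz)
    exact ((h z (mem_of_mem_nhds hb)).contMDiffAt hb).mdifferentiableAt (by simp)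
  · have h1 := congrArg (fun A : EuclideanSpace ℝ (Fin n) →L[ℝ] EuclideanSpace ℝ (Fin n) => A u)
      (hs z hz)
    have h2 := mfderiv_extChartAt_comp_mfderivWithin_extChartAt_symm' (I := 𝓡 n) hz
    rw [(𝓡 n).range_eq_univ, mfderivWithin_univ] at h2
    refine (congrArg (mvfderiv (𝓡 n) (extChartAt (𝓡 n) p) z) h1).trans ?_
    exact congrArg (fun A : EuclideanSpace ℝ (Fin n) →L[ℝ] EuclideanSpace ℝ (Fin n) => A u) h2
  · have h1 := congrArg (fun A : EuclideanSpace ℝ (Fin n) →L[ℝ] EuclideanSpace ℝ (Fin n) => A u)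
      (hs z hz)
    refine (congrArg (α z) h1).trans ?_
    have h2 := (extChartAt (𝓡 n) p).left_inv hz
    exact congrArg (fun m : M => (α m : EuclideanSpace ℝ (Fin n) →L[ℝ] ℝ)
      (mfderiv 𝓘(ℝ, EuclideanSpace ℝ (Fin n)) (𝓡 n) (extChartAt (𝓡 n) p).symm
        (extChartAt (𝓡 n) p z) u)) h2.symm

/-- The coordinate expression of a closed form has symmetric derivative. -/
lemma fderiv_coordCovector_symm {α : OneForm (𝓡 n) M} (hα : SmoothOneForm (𝓡 n) α)
    (hd : ∀ x v w, extD α x ![v, w] = 0) (p : M) {y : EuclideanSpace ℝ (Fin n)}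
    (hy : y ∈ (extChartAt (𝓡 n) p).target) (u v : EuclideanSpace ℝ (Fin n)) :
    fderiv ℝ (coordCovector α p) y u v = fderiv ℝ (coordCovector α p) y v u := by
  obtain ⟨X, hX, hXu, hXα⟩ := exists_coordinate_field p u
  obtain ⟨Y, hY, hYv, hYα⟩ := exists_coordinate_field p v
  set e := extChartAt (𝓡 n) p with he
  set z := e.symm y with hz
  have hzs : z ∈ e.source := e.map_target hy
  have hez : e z = y := e.right_inv hy
  have hnhds : e.source ∈ 𝓝 z := (isOpen_extChartAt_source p).mem_nhds hzs
  have hes : ContMDiffAt (𝓡 n) 𝓘(ℝ, EuclideanSpace ℝ (Fin n)) 2 e z :=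
    contMDiffAt_extChartAt' (by simpa [he] using hzs)
  have hω : DifferentiableAt ℝ (coordCovector α p) (e z) := by
    rw [hez]
    exact ((contDiffOn_coordCovector hα p).contDiffAt
      ((isOpen_extChartAt_target p).mem_nhds hy)).differentiableAt (by simp)
  have key (W U : VecField (𝓡 n) M) (w t : EuclideanSpace ℝ (Fin n))
      (hW : ∀ m ∈ e.source, α m (W m) = coordCovector α p (e m) w)
      (hU : mvfderiv (𝓡 n) e z (U z) = t) :
      mvfderiv (𝓡 n) (fun m => α m (W m)) z (U z) = fderiv ℝ (coordCovector α p) y t w := by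
    have hev : (fun m => α m (W m)) =ᶠ[𝓝 z] fun m => (fun y => coordCovector α p y w) (e m) := by
      filter_upwards [hnhds] with m hm using hW m hm
    have hd' : DifferentiableAt ℝ (fun y => coordCovector α p y w) (e z) :=
      hω.clm_apply (differentiableAt_const _)
    rw [mvfderiv_congr hev]
    refine (mvfderiv_comp_apply' (I' := 𝓘(ℝ, EuclideanSpace ℝ (Fin n)))
      (g := fun y => coordCovector α p y w) hd'.mdifferentiableAt
      (hes.mdifferentiableAt (by simp)) (U z)).trans ?_
    refine (congrArg (mvfderiv 𝓘(ℝ, EuclideanSpace ℝ (Fin n))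
      (fun y => coordCovector α p y w) (e z)) hU).trans ?_
    unfold mvfderiv
    rw [mfderiv_eq_fderiv, hez]
    rw [hez] at hω
    rw [fderiv_clm_apply hω (differentiableAt_const w)]
    simp
    rfl
  have hb : mlieBracket (𝓡 n) X Y z = 0 := by
    have h1 := mvfderiv_mlieBracket hes (hX z hzs) (hY z hzs)
    have c1 : (fun m => mvfderiv (𝓡 n) e m (Y m)) =ᶠ[𝓝 z] fun _ => v := by
      filter_upwards [hnhds] with m hm using hYv m hm
    have c2 : (fun m => mvfderiv (𝓡 n) e m (X m)) =ᶠ[𝓝 z] fun _ => u := by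
      filter_upwards [hnhds] with m hm using hXu m hm
    rw [mvfderiv_congr c1, mvfderiv_congr c2, mvfderiv_const, mvfderiv_const] at h1
    have h2 : mfderiv (𝓡 n) 𝓘(ℝ, EuclideanSpace ℝ (Fin n)) e z (mlieBracket (𝓡 n) X Y z)
        = mfderiv (𝓡 n) 𝓘(ℝ, EuclideanSpace ℝ (Fin n)) e z 0 :=
      h1.trans ((sub_self _).trans (map_zero _).symm)
    exact (isInvertible_mfderiv_extChartAt hzs).injective h2
  have h := extD_apply hα (hX z hzs) (hY z hzs)
  rw [hd, hb, map_zero, sub_zero, key Y X v u (hYα α) (hXu z hzs), key X Y u v (hXα α) (hYv z hzs)] at h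
  exact (sub_eq_zero.1 h.symm)

/-- A closed form has local primitives. -/
lemma exists_primitive_coordCovector {α : OneForm (𝓡 n) M} (hα : SmoothOneForm (𝓡 n) α)
    (hd : ∀ x v w, extD α x ![v, w] = 0) (p : M) :
    ∃ (s : Set (EuclideanSpace ℝ (Fin n))) (f : EuclideanSpace ℝ (Fin n) → ℝ), IsOpen s ∧
      extChartAt (𝓡 n) p p ∈ s ∧ s ⊆ (extChartAt (𝓡 n) p).target ∧ ContDiffOn ℝ ∞ f s ∧
      ∀ y ∈ s, HasFDerivAt f (coordCovector α p y) y := by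
  obtain ⟨r, hr, hball⟩ := Metric.isOpen_iff.1 (isOpen_extChartAt_target (I := 𝓡 n) p) _
    (mem_extChartAt_target (I := 𝓡 n) p)
  have hω := (contDiffOn_coordCovector hα p).mono hball
  obtain ⟨f, hf⟩ := (convex_ball (extChartAt (𝓡 n) p p) r).exists_forall_hasFDerivAt_of_fderiv_symmetric
    Metric.isOpen_ball (hω.differentiableOn (by simp))
    (fun y hy u v => fderiv_coordCovector_symm hα hd p (hball hy) u v)
  refine ⟨Metric.ball (extChartAt (𝓡 n) p p) r, f, Metric.isOpen_ball, Metric.mem_ball_self hr,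
    hball, ?_, hf⟩
  rw [contDiffOn_infty_iff_fderiv_of_isOpen Metric.isOpen_ball]
  exact ⟨fun y hy => (hf y hy).differentiableAt.differentiableWithinAt,
    hω.congr fun y hy => (hf y hy).fderiv⟩

end Primitive

section LinearAlgebra

/-- A nonzero linear form is the first component of an isomorphism with `ℝ × ℝᵈ`. -/
lemma exists_linearEquiv_prod {d : ℕ} (η : EuclideanSpace ℝ (Fin (d + 1)) →L[ℝ] ℝ) (hη : η ≠ 0) :
    ∃ q : EuclideanSpace ℝ (Fin (d + 1)) →L[ℝ] EuclideanSpace ℝ (Fin d),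
      ∃ e : EuclideanSpace ℝ (Fin (d + 1)) ≃L[ℝ] ℝ × EuclideanSpace ℝ (Fin d),
        (e : EuclideanSpace ℝ (Fin (d + 1)) →L[ℝ] ℝ × EuclideanSpace ℝ (Fin d)) = η.prod q := by
  obtain ⟨w, hw⟩ : ∃ w, η w = 1 := by
    obtain ⟨v, hv⟩ := DFunLike.ne_iff.1 hη
    exact ⟨(η v)⁻¹ • v, by simpa using inv_mul_cancel₀ hv⟩
  have hsurj : η.toLinearMap.range = ⊤ :=
    LinearMap.range_eq_top.2 fun c => ⟨c • w, by simp [hw]⟩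
  have hker : Module.finrank ℝ η.toLinearMap.ker = Module.finrank ℝ (EuclideanSpace ℝ (Fin d)) := by
    have h := η.toLinearMap.finrank_range_add_finrank_ker
    rw [hsurj, finrank_top, finrank_euclideanSpace_fin, Module.finrank_self] at h
    rw [finrank_euclideanSpace_fin]
    omega
  let κ := LinearEquiv.ofFinrankEq _ _ hker
  let P : EuclideanSpace ℝ (Fin (d + 1)) →ₗ[ℝ] η.toLinearMap.ker :=
    LinearMap.codRestrict _ (LinearMap.id - η.toLinearMap.smulRight w) fun v => by simp [hw]
  let q := LinearMap.toContinuousLinearMap (κ.toLinearMap ∘ₗ P)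
  have hinj : Function.Injective (η.prod q).toLinearMap := by
    rw [injective_iff_map_eq_zero]
    intro v hv
    have h1 : η v = 0 := congrArg Prod.fst hv
    have h2 : κ (P v) = 0 := congrArg Prod.snd hv
    have h3 : v - η v • w = 0 := congrArg Subtype.val ((LinearEquiv.map_eq_zero_iff κ).1 h2)
    rwa [h1, zero_smul, sub_zero] at h3
  refine ⟨q, (LinearEquiv.ofInjectiveOfFinrankEq _ hinj ?_).toContinuousLinearEquiv, ?_⟩
  · simp [add_comm]
  · ext v <;> rfl

end LinearAlgebra

section AdaptedChart

variable {d : ℕ} {M : Type*} [TopologicalSpace M]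
  [ChartedSpace (EuclideanSpace ℝ (Fin (d + 1))) M]

/-- A chart with values in `ℝ × ℝᵈ` such that `α` is the differential of the first coordinate. -/
structure IsAdaptedChart (α : OneForm (𝓡 (d + 1)) M)
    (Θ : OpenPartialHomeomorph M (ℝ × EuclideanSpace ℝ (Fin d))) : Prop where
  smooth : ContMDiffOn (𝓡 (d + 1)) 𝓘(ℝ, ℝ × EuclideanSpace ℝ (Fin d)) ∞ Θ Θ.source
  smooth_symm : ContMDiffOn 𝓘(ℝ, ℝ × EuclideanSpace ℝ (Fin d)) (𝓡 (d + 1)) ∞ Θ.symm Θ.target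
  mvfderiv_fst : ∀ y ∈ Θ.source, ∀ v, mvfderiv (𝓡 (d + 1)) (fun z => (Θ z).1) y v = α y v

variable [IsManifold (𝓡 (d + 1)) ∞ M]

/-- A nowhere vanishing closed `1`-form has adapted charts. -/
theorem exists_isAdaptedChart {α : OneForm (𝓡 (d + 1)) M} (hα : SmoothOneForm (𝓡 (d + 1)) α)
    (hd : ∀ x v w, extD α x ![v, w] = 0) (hne : ∀ x, α x ≠ 0) (p : M) :
    ∃ Θ : OpenPartialHomeomorph M (ℝ × EuclideanSpace ℝ (Fin d)),
      p ∈ Θ.source ∧ IsAdaptedChart α Θ := by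
  obtain ⟨s, f, hso, hps, hst, hf, hdf⟩ := exists_primitive_coordCovector hα hd p
  set e := extChartAt (𝓡 (d + 1)) p with he
  set y₀ := e p
  have hy₀ := hst hps
  have hη₀ : coordCovector α p y₀ ≠ 0 := by
    intro h0
    refine hne p ?_
    ext v
    obtain ⟨X, -, hXu, hXα⟩ := exists_coordinate_field p
      (mvfderiv (𝓡 (d + 1)) e p v : EuclideanSpace ℝ (Fin (d + 1)))
    have hp : p ∈ e.source := mem_extChartAt_source p
    have h1 : X p = v := (isInvertible_mfderiv_extChartAt hp).injective (hXu p hp)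
    have h2 := hXα α p hp
    rw [h1, h0] at h2
    exact h2
  obtain ⟨q, e₀, he₀⟩ := exists_linearEquiv_prod _ hη₀
  set G : EuclideanSpace ℝ (Fin (d + 1)) → ℝ × EuclideanSpace ℝ (Fin d) := fun y => (f y, q y)
  have hG (y) (hy : y ∈ s) : ContDiffAt ℝ ∞ G y :=
    (hf.contDiffAt (hso.mem_nhds hy)).prodMk q.contDiff.contDiffAt
  have hG' (y) (hy : y ∈ s) : HasFDerivAt G ((coordCovector α p y).prod q) y :=
    (hdf y hy).prodMk q.hasFDerivAt
  have hG₀ : HasFDerivAt G (e₀ : EuclideanSpace ℝ (Fin (d + 1)) →L[ℝ] _) y₀ := he₀ ▸ hG' y₀ hps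
  set Ψ := (hG y₀ hps).toOpenPartialHomeomorph G hG₀ (by simp)
  have hΨ : (Ψ : _ → _) = G := (hG y₀ hps).toOpenPartialHomeomorph_coe hG₀ (by simp)
  have hΨy₀ : y₀ ∈ Ψ.source := (hG y₀ hps).mem_toOpenPartialHomeomorph_source hG₀ (by simp)
  set inv : Set (EuclideanSpace ℝ (Fin (d + 1)) →L[ℝ] ℝ × EuclideanSpace ℝ (Fin d)) :=
    range (fun A : EuclideanSpace ℝ (Fin (d + 1)) ≃L[ℝ] ℝ × EuclideanSpace ℝ (Fin d) =>
      (A : EuclideanSpace ℝ (Fin (d + 1)) →L[ℝ] ℝ × EuclideanSpace ℝ (Fin d)))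
  have hinv : IsOpen inv := ContinuousLinearEquiv.isOpen
  set t := s ∩ (fun y => (coordCovector α p y).prod q) ⁻¹' inv
  have hto : IsOpen t := by
    refine ContinuousOn.isOpen_inter_preimage ?_ hso hinv
    have hc := ((contDiffOn_coordCovector hα p).mono hst).continuousOn
    exact (ContinuousLinearMap.prodₗᵢ ℝ).continuous.comp_continuousOn (hc.prodMk continuousOn_const)
  have hty₀ : y₀ ∈ t := ⟨hps, e₀, he₀⟩
  set Ψ' := Ψ.restrOpen t hto
  have hΨ's : Ψ'.source = Ψ.source ∩ t := rfl
  have hΨ'c (y) : Ψ' y = G y := congrFun hΨ y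
  have hΨ'd : ContDiffOn ℝ ∞ Ψ' Ψ'.source := fun y hy =>
    ((hG y hy.2.1).congr_of_eventuallyEq (.of_forall hΨ'c)).contDiffWithinAt
  have hΨ'sd : ContDiffOn ℝ ∞ Ψ'.symm Ψ'.target := fun z hz => by
    have hz' := Ψ'.map_target hz
    obtain ⟨A, hA⟩ := hz'.2.2
    refine (Ψ'.contDiffAt_symm (f₀' := A) hz ?_ ?_).contDiffWithinAt
    · refine HasFDerivAt.congr_of_eventuallyEq ?_ (.of_forall hΨ'c)
      exact (hG' _ hz'.2.1).congr_fderiv hA.symm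
    · exact (hG _ hz'.2.1).congr_of_eventuallyEq (.of_forall hΨ'c)
  refine ⟨(chartAt (EuclideanSpace ℝ (Fin (d + 1))) p).trans Ψ', ?_, ?_, ?_, ?_⟩
  · simp only [OpenPartialHomeomorph.trans_source]
    exact ⟨mem_chart_source _ p, hΨy₀, hty₀⟩
  · refine hΨ'd.contMDiffOn.comp (contMDiffOn_chart.mono fun y hy => hy.1) ?_
    exact fun y hy => hy.2
  · refine contMDiffOn_chart_symm.comp (hΨ'sd.contMDiffOn.mono fun y hy => hy.1) ?_
    exact fun y hy => hy.2
  · intro y hy v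
    have hys : y ∈ e.source := by simpa [he] using hy.1
    have hyt : e y ∈ t := hy.2.2
    obtain ⟨X, -, hXu, hXα⟩ := exists_coordinate_field p
      (mvfderiv (𝓡 (d + 1)) e y v : EuclideanSpace ℝ (Fin (d + 1)))
    have h1 : X y = v := (isInvertible_mfderiv_extChartAt hys).injective (hXu y hys)
    have h2 := hXα α y hys
    rw [h1] at h2
    have hes : ContMDiffAt (𝓡 (d + 1)) 𝓘(ℝ, EuclideanSpace ℝ (Fin (d + 1))) 2 e y :=
      contMDiffAt_extChartAt' (by simpa [he] using hys)
    have h3 := hdf _ hyt.1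
    have h4 : (fun z => (((chartAt (EuclideanSpace ℝ (Fin (d + 1))) p).trans Ψ') z).1)
      = fun z => f (e z) := by
      funext z
      exact congrArg Prod.fst (hΨ'c _)
    rw [h4, h2]
    refine (mvfderiv_comp_apply' (I' := 𝓘(ℝ, EuclideanSpace ℝ (Fin (d + 1)))) (g := f)
      h3.differentiableAt.mdifferentiableAt (hes.mdifferentiableAt (by simp)) v).trans ?_
    unfold mvfderiv
    rw [mfderiv_eq_fderiv, h3.fderiv]
    rfl

end AdaptedChart

section LocallyConstant

variable {E : Type*} [NormedAddCommGroup E] [NormedSpace ℝ E]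
  {H : Type*} [TopologicalSpace H] {I : ModelWithCorners ℝ E H} [I.Boundaryless]
  {N : Type*} [TopologicalSpace N] [ChartedSpace H N] [IsManifold I ∞ N]

/-- A function with vanishing differential on an open set is locally constant there. -/
lemma eventually_eq_of_mvfderiv_eq_zero {g : N → ℝ} {s : Set N} (hs : IsOpen s)
    (hg : ∀ y ∈ s, MDifferentiableAt I 𝓘(ℝ, ℝ) g y) (h0 : ∀ y ∈ s, ∀ v, mvfderiv I g y v = 0)
    {x : N} (hx : x ∈ s) : ∀ᶠ y in 𝓝 x, g y = g x := by
  set e := extChartAt I x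
  set t := e.target ∩ e.symm ⁻¹' s
  have ht : IsOpen t := (continuousOn_extChartAt_symm x).isOpen_inter_preimage
    (isOpen_extChartAt_target x) hs
  have hsymm (y) (hy : y ∈ e.target) : MDifferentiableAt 𝓘(ℝ, E) I e.symm y :=
    ((contMDiffOn_extChartAt_symm (n := ∞) x).contMDiffAt
      ((isOpen_extChartAt_target x).mem_nhds hy)).mdifferentiableAt (by simp)
  have hd (y) (hy : y ∈ t) : HasFDerivAt (g ∘ e.symm) (0 : E →L[ℝ] ℝ) y := by
    have h1 : MDifferentiableAt 𝓘(ℝ, E) 𝓘(ℝ, ℝ) (g ∘ e.symm) y := (hg _ hy.2).comp y (hsymm y hy.1)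
    have h2 := h1.differentiableAt.hasFDerivAt
    refine h2.congr_fderiv ?_
    refine ContinuousLinearMap.ext fun v => ?_
    have h3 := mvfderiv_comp_apply' (I := 𝓘(ℝ, E)) (f := e.symm) (hg _ hy.2) (hsymm y hy.1) v
    rw [h0 _ hy.2] at h3
    unfold mvfderiv at h3
    rw [mfderiv_eq_fderiv] at h3
    exact h3
  have hopen := ht.isOpen_inter_preimage_of_fderiv_eq_zero
    (fun y hy => (hd y hy).differentiableAt.differentiableWithinAt)
    (fun y hy => (hd y hy).fderiv) {g x}
  have hxx : e.symm (e x) = x := extChartAt_to_inv x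
  have hmem : e x ∈ t ∩ (g ∘ e.symm) ⁻¹' {g x} :=
    ⟨⟨mem_extChartAt_target x, by rw [mem_preimage, hxx]; exact hx⟩, by simp [hxx]⟩
  filter_upwards [(continuousAt_extChartAt x).preimage_mem_nhds (hopen.mem_nhds hmem),
    extChartAt_source_mem_nhds (I := I) x] with y hy hys
  have h4 : g (e.symm (e y)) = g x := hy.2
  rwa [e.left_inv hys] at h4

end LocallyConstant

section Slices

variable {d : ℕ} {M : Type u} [TopologicalSpace M]
  [ChartedSpace (EuclideanSpace ℝ (Fin (d + 1))) M]

/-- The restriction of a chart with values in `ℝ × ℝᵈ` to a level set of the first coordinate. -/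
@[simps]
def sliceEquiv (Θ : OpenPartialHomeomorph M (ℝ × EuclideanSpace ℝ (Fin d))) (c : ℝ) :
    PartialEquiv M (EuclideanSpace ℝ (Fin d)) where
  toFun y := (Θ y).2
  invFun z := Θ.symm (c, z)
  source := {y | y ∈ Θ.source ∧ (Θ y).1 = c}
  target := {z | (c, z) ∈ Θ.target}
  map_source' y hy := by
    have h : (c, (Θ y).2) = Θ y := Prod.ext hy.2.symm rfl
    change (c, (Θ y).2) ∈ Θ.target
    rw [h]
    exact Θ.map_source hy.1
  map_target' z hz := ⟨Θ.map_target hz, by rw [Θ.right_inv hz]⟩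
  left_inv' y hy := by
    have h : (c, (Θ y).2) = Θ y := Prod.ext hy.2.symm rfl
    rw [h, Θ.left_inv hy.1]
  right_inv' z hz := by rw [Θ.right_inv hz]

variable {α : OneForm (𝓡 (d + 1)) M}
  {Θ Θ' : OpenPartialHomeomorph M (ℝ × EuclideanSpace ℝ (Fin d))}

omit [ChartedSpace (EuclideanSpace ℝ (Fin (d + 1))) M] in
lemma isOpen_slice_target (Θ : OpenPartialHomeomorph M (ℝ × EuclideanSpace ℝ (Fin d))) (c : ℝ) :
    IsOpen {z | (c, z) ∈ Θ.target} :=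
  Θ.open_target.preimage (by fun_prop)

omit [ChartedSpace (EuclideanSpace ℝ (Fin (d + 1))) M] in
lemma isOpen_slice_inter (Θ Θ' : OpenPartialHomeomorph M (ℝ × EuclideanSpace ℝ (Fin d))) (c : ℝ) :
    IsOpen {z | (c, z) ∈ Θ.target ∧ Θ.symm (c, z) ∈ Θ'.source} := by
  have h := Θ.symm.continuousOn.isOpen_inter_preimage Θ.symm.open_source Θ'.open_source
  exact h.preimage (f := fun z : EuclideanSpace ℝ (Fin d) => (c, z)) (by fun_prop)

lemma IsAdaptedChart.contMDiffOn_slice_symm (h : IsAdaptedChart α Θ) (c : ℝ) :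
    ContMDiffOn (𝓡 d) (𝓡 (d + 1)) ∞ (fun z => Θ.symm (c, z)) {z | (c, z) ∈ Θ.target} :=
  h.smooth_symm.comp (g := Θ.symm) (f := fun z : EuclideanSpace ℝ (Fin d) => (c, z))
    (contDiff_const.prodMk contDiff_id).contMDiff.contMDiffOn (fun _ hz => hz)

lemma IsAdaptedChart.contMDiffOn_transition (h : IsAdaptedChart α Θ) (h' : IsAdaptedChart α Θ')
    (c : ℝ) : ContMDiffOn (𝓡 d) 𝓘(ℝ, ℝ × EuclideanSpace ℝ (Fin d)) ∞
      (fun z => Θ' (Θ.symm (c, z))) {z | (c, z) ∈ Θ.target ∧ Θ.symm (c, z) ∈ Θ'.source} :=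
  h'.smooth.comp ((h.contMDiffOn_slice_symm c).mono fun _ hz => hz.1) fun _ hz => hz.2

/-- Along a map tangent to the kernel of `α` the first coordinate has vanishing differential. -/
lemma IsAdaptedChart.mvfderiv_fst_comp {E : Type*} [NormedAddCommGroup E] [NormedSpace ℝ E]
    {H : Type*} [TopologicalSpace H] {I : ModelWithCorners ℝ E H}
    {N : Type*} [TopologicalSpace N] [ChartedSpace H N] (h : IsAdaptedChart α Θ) {j : N → M} {x : N}
    (hj : MDifferentiableAt I (𝓡 (d + 1)) j x) (hx : j x ∈ Θ.source) (v : TangentSpace I x) :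
    MDifferentiableAt I 𝓘(ℝ, ℝ) (fun y => (Θ (j y)).1) x ∧
    mvfderiv I (fun y => (Θ (j y)).1) x v = α (j x) (mfderiv I (𝓡 (d + 1)) j x v) := by
  have h1 : MDifferentiableAt (𝓡 (d + 1)) 𝓘(ℝ, ℝ) (fun y => (Θ y).1) (j x) :=
    (contDiff_fst (n := ∞)).contMDiff.contMDiffAt.comp (j x)
      (h.smooth.contMDiffAt (Θ.open_source.mem_nhds hx)) |>.mdifferentiableAt (by simp)
  refine ⟨h1.comp x hj, ?_⟩
  rw [mvfderiv_comp_apply' h1 hj, h.mvfderiv_fst _ hx]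

lemma IsAdaptedChart.isOpen_slice (h : IsAdaptedChart α Θ) (h' : IsAdaptedChart α Θ') (c c' : ℝ) :
    IsOpen {z | (c, z) ∈ Θ.target ∧ Θ.symm (c, z) ∈ Θ'.source ∧ (Θ' (Θ.symm (c, z))).1 = c'} := by
  rw [isOpen_iff_mem_nhds]
  intro z₀ hz₀
  have hU := isOpen_slice_inter Θ Θ' c
  have hσ (z) (hz : (c, z) ∈ Θ.target) :
      MDifferentiableAt (𝓡 d) (𝓡 (d + 1)) (fun z => Θ.symm (c, z)) z :=
    ((h.contMDiffOn_slice_symm c).contMDiffAt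
      ((isOpen_slice_target Θ c).mem_nhds hz)).mdifferentiableAt (by simp)
  have hev := eventually_eq_of_mvfderiv_eq_zero (I := 𝓡 d)
    (g := fun z => (Θ' (Θ.symm (c, z))).1) hU
    (fun z hz => (h'.mvfderiv_fst_comp (hσ z hz.1) hz.2 0).1) (fun z hz v => by
      rw [(h'.mvfderiv_fst_comp (hσ z hz.1) hz.2 v).2,
        ← (h.mvfderiv_fst_comp (hσ z hz.1) (Θ.map_target hz.1) v).2]
      have hc : (fun z => (Θ (Θ.symm (c, z))).1) =ᶠ[𝓝 z] fun _ => c := by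
        filter_upwards [(isOpen_slice_target Θ c).mem_nhds hz.1] with w hw
        rw [Θ.right_inv hw]
      rw [mvfderiv_congr hc, mvfderiv_const]
      rfl) (x := z₀) ⟨hz₀.1, hz₀.2.1⟩
  filter_upwards [hev, hU.mem_nhds ⟨hz₀.1, hz₀.2.1⟩] with z hz hzU
  exact ⟨hzU.1, hzU.2, hz.trans hz₀.2.2⟩

/-- A choice of adapted charts around all points. -/
structure AdaptedFamily (α : OneForm (𝓡 (d + 1)) M) where
  chart : M → OpenPartialHomeomorph M (ℝ × EuclideanSpace ℝ (Fin d))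
  mem_source : ∀ p, p ∈ (chart p).source
  adapted : ∀ p, IsAdaptedChart α (chart p)

namespace AdaptedFamily

variable (F : AdaptedFamily α)

/-- The atlas of slices of adapted charts. -/
def core : ChartedSpaceCore (EuclideanSpace ℝ (Fin d)) M where
  atlas := {e | ∃ p c, e = sliceEquiv (F.chart p) c}
  chartAt p := sliceEquiv (F.chart p) (F.chart p p).1
  mem_chart_source p := ⟨F.mem_source p, rfl⟩
  chart_mem_atlas p := ⟨p, _, rfl⟩
  open_source := by
    rintro _ _ ⟨p, c, rfl⟩ ⟨p', c', rfl⟩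
    exact (F.adapted p).isOpen_slice (F.adapted p') c c'
  continuousOn_toFun := by
    rintro _ _ ⟨p, c, rfl⟩ ⟨p', c', rfl⟩
    exact continuous_snd.comp_continuousOn
      (((F.adapted p).contMDiffOn_transition (F.adapted p') c).continuousOn.mono
        fun z hz => ⟨hz.1, hz.2.1⟩)

/-- The manifold `M` with the leaf topology. -/
def LeafSpace (_ : AdaptedFamily α) : Type u := M

instance : TopologicalSpace F.LeafSpace := F.core.toTopologicalSpace

instance : ChartedSpace (EuclideanSpace ℝ (Fin d)) F.LeafSpace := F.core.toChartedSpace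

lemma exists_slice_of_mem_atlas {e : OpenPartialHomeomorph F.LeafSpace (EuclideanSpace ℝ (Fin d))}
    (he : e ∈ atlas (EuclideanSpace ℝ (Fin d)) F.LeafSpace) :
    ∃ p c, e.toPartialEquiv = sliceEquiv (F.chart p) c := by
  obtain ⟨f, hf⟩ := mem_iUnion.1 he
  obtain ⟨⟨p, c, rfl⟩, hf⟩ := mem_iUnion.1 hf
  obtain rfl := mem_singleton_iff.1 hf
  exact ⟨p, c, rfl⟩

instance : IsManifold (𝓡 d) ∞ F.LeafSpace := by
  refine isManifold_of_contDiffOn _ _ _ fun e e' he he' => ?_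
  obtain ⟨p, c, he⟩ := F.exists_slice_of_mem_atlas he
  obtain ⟨p', c', he'⟩ := F.exists_slice_of_mem_atlas he'
  have h := ((F.adapted p).contMDiffOn_transition (F.adapted p') c).contDiffOn
  have h1 : ((𝓡 d) ∘ e.symm.trans e' ∘ (𝓡 d).symm)
      = fun z => (F.chart p' ((F.chart p).symm (c, z))).2 := by
    change (fun z => e'.toPartialEquiv (e.toPartialEquiv.symm z)) = _
    rw [he, he']
    rfl
  have h2 : (e.symm.trans e').source = (e.toPartialEquiv.symm.trans e'.toPartialEquiv).source := rfl
  rw [h1, h2, he, he']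
  exact contDiff_snd.comp_contDiffOn (h.mono fun z hz => ⟨hz.1.1, hz.1.2.1⟩)

/-- The identity map from the leaf space to `M`. -/
def toM (x : F.LeafSpace) : M := x

/-- The identity map from `M` to the leaf space. -/
def ofM (x : M) : F.LeafSpace := x

lemma chartAt_source (x : F.LeafSpace) :
    (chartAt (EuclideanSpace ℝ (Fin d)) x).source
      = {y : F.LeafSpace | F.toM y ∈ (F.chart (F.toM x)).source ∧
        (F.chart (F.toM x) (F.toM y)).1 = (F.chart (F.toM x) (F.toM x)).1} := rfl

end AdaptedFamily

end Slices

section Leaf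

variable {d : ℕ} {M : Type u} [TopologicalSpace M]
  [ChartedSpace (EuclideanSpace ℝ (Fin (d + 1))) M] {α : OneForm (𝓡 (d + 1)) M}

/-- A map that reads in charts as the inclusion of slices of adapted charts is an immersion
tangent to the kernel of `α`. -/
theorem isKernelImmersion_of_slices {L : Type*} [TopologicalSpace L]
    [ChartedSpace (EuclideanSpace ℝ (Fin d)) L] [IsManifold (𝓡 d) ∞ L] {i : L → M}
    (hne : ∀ x, α x ≠ 0)
    (hi : ∀ x : L, ∃ (Θ : OpenPartialHomeomorph M (ℝ × EuclideanSpace ℝ (Fin d))) (c : ℝ),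
      IsAdaptedChart α Θ ∧ ∀ y ∈ (chartAt (EuclideanSpace ℝ (Fin d)) x).source,
        i y ∈ Θ.source ∧ Θ (i y) = (c, chartAt (EuclideanSpace ℝ (Fin d)) x y)) :
    IsKernelImmersion d α i := by
  have hsm : ContMDiff (𝓡 d) (𝓡 (d + 1)) ∞ i := by
    intro x
    obtain ⟨Θ, c, hΘ, hx⟩ := hi x
    have h1 : ContMDiffOn (𝓡 d) (𝓡 (d + 1)) ∞
        (fun y => Θ.symm (c, chartAt (EuclideanSpace ℝ (Fin d)) x y))
        (chartAt (EuclideanSpace ℝ (Fin d)) x).source := by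
      refine (hΘ.contMDiffOn_slice_symm c).comp contMDiffOn_chart fun y hy => ?_
      change (c, chartAt (EuclideanSpace ℝ (Fin d)) x y) ∈ Θ.target
      rw [← (hx y hy).2]
      exact Θ.map_source (hx y hy).1
    refine (h1.congr fun y hy => ?_).contMDiffAt (chart_source_mem_nhds _ x)
    rw [← (hx y hy).2, Θ.left_inv (hx y hy).1]
  have hdi (x) : MDifferentiableAt (𝓡 d) (𝓡 (d + 1)) i x := (hsm x).mdifferentiableAt (by simp)
  have himm (x) : Function.Injective (mfderiv (𝓡 d) (𝓡 (d + 1)) i x) := by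
    obtain ⟨Θ, c, hΘ, hx⟩ := hi x
    have hxs := mem_chart_source (EuclideanSpace ℝ (Fin d)) x
    have h2 : MDifferentiableAt (𝓡 (d + 1)) (𝓡 d) (fun y => (Θ y).2) (i x) :=
      (contDiff_snd (n := ∞)).contMDiff.contMDiffAt.comp (i x)
        (hΘ.smooth.contMDiffAt (Θ.open_source.mem_nhds (hx x hxs).1)) |>.mdifferentiableAt (by simp)
    have hev : (fun y => (Θ (i y)).2) =ᶠ[𝓝 x] extChartAt (𝓡 d) x := by
      filter_upwards [chart_source_mem_nhds (EuclideanSpace ℝ (Fin d)) x] with y hy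
      rw [(hx y hy).2]
      rfl
    have h3 := isInvertible_mfderiv_extChartAt (I := 𝓡 d) (mem_extChartAt_source (I := 𝓡 d) x)
    intro u v huv
    refine h3.injective ?_
    have h4 (w : TangentSpace (𝓡 d) x) : mfderiv (𝓡 d) 𝓘(ℝ, EuclideanSpace ℝ (Fin d))
        (extChartAt (𝓡 d) x) x w = mfderiv (𝓡 (d + 1)) 𝓘(ℝ, EuclideanSpace ℝ (Fin d))
          (fun y => (Θ y).2) (i x) (mfderiv (𝓡 d) (𝓡 (d + 1)) i x w) :=
      (congrArg (fun A : EuclideanSpace ℝ (Fin d) →L[ℝ] EuclideanSpace ℝ (Fin d) => A w)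
        hev.mfderiv_eq.symm).trans (mfderiv_comp_apply x h2 (hdi x) w)
    rw [h4, h4, huv]
  have hker (x) (u : TangentSpace (𝓡 d) x) : α (i x) (mfderiv (𝓡 d) (𝓡 (d + 1)) i x u) = 0 := by
    obtain ⟨Θ, c, hΘ, hx⟩ := hi x
    have hxs := mem_chart_source (EuclideanSpace ℝ (Fin d)) x
    rw [← (hΘ.mvfderiv_fst_comp (hdi x) (hx x hxs).1 u).2]
    have hev : (fun y => (Θ (i y)).1) =ᶠ[𝓝 x] fun _ => c := by
      filter_upwards [chart_source_mem_nhds (EuclideanSpace ℝ (Fin d)) x] with y hy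
      rw [(hx y hy).2]
    rw [mvfderiv_congr hev, mvfderiv_const]
    rfl
  refine ⟨hsm, himm, fun x v => ⟨?_, fun hv => ?_⟩⟩
  · rintro ⟨u, rfl⟩
    exact hker x u
  · let D : EuclideanSpace ℝ (Fin d) →ₗ[ℝ] EuclideanSpace ℝ (Fin (d + 1)) :=
      (mfderiv (𝓡 d) (𝓡 (d + 1)) i x).toLinearMap
    let a : EuclideanSpace ℝ (Fin (d + 1)) →ₗ[ℝ] ℝ := (α (i x)).toLinearMap
    have hle : D.range ≤ a.ker := by
      rintro _ ⟨u, rfl⟩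
      exact hker x u
    have ha : a ≠ 0 := fun h0 => hne (i x) (by ext w; exact congrArg (fun f => f w) h0)
    have hD : Function.Injective D := himm x
    have h1 : Module.finrank ℝ D.range = d := by
      rw [LinearMap.finrank_range_of_inj hD, finrank_euclideanSpace_fin]
    have h2 : Module.finrank ℝ a.ker + 1 = d + 1 := by
      have h := Module.Dual.finrank_ker_add_one_of_ne_zero (f := a) ha
      rwa [finrank_euclideanSpace_fin] at h
    have heq := Submodule.eq_of_le_of_finrank_eq hle (by omega)
    have hv' : (v : EuclideanSpace ℝ (Fin (d + 1))) ∈ a.ker := hv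
    rw [← heq] at hv'
    exact hv'

namespace AdaptedFamily

variable (F : AdaptedFamily α)

/-- Maps tangent to the kernel of `α` are continuous for the leaf topology. -/
lemma continuous_toLeafSpace {N : Type*} [TopologicalSpace N]
    [ChartedSpace (EuclideanSpace ℝ (Fin d)) N] [IsManifold (𝓡 d) ∞ N] {j : N → M}
    (hj : ContMDiff (𝓡 d) (𝓡 (d + 1)) ∞ j)
    (hker : ∀ x v, α (j x) (mfderiv (𝓡 d) (𝓡 (d + 1)) j x v) = 0) :
    Continuous (fun x => F.ofM (j x)) := by
  rw [continuous_iff_continuousAt]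
  intro x
  set Θ := F.chart (j x)
  have hΘ := F.adapted (j x)
  set s := j ⁻¹' Θ.source
  have hs : IsOpen s := Θ.open_source.preimage hj.continuous
  have hx : x ∈ s := F.mem_source (j x)
  have hdj (y) : MDifferentiableAt (𝓡 d) (𝓡 (d + 1)) j y := (hj y).mdifferentiableAt (by simp)
  have hev := eventually_eq_of_mvfderiv_eq_zero (I := 𝓡 d) (g := fun y => (Θ (j y)).1) hs
    (fun y hy => (hΘ.mvfderiv_fst_comp (hdj y) hy 0).1)
    (fun y hy v => by rw [(hΘ.mvfderiv_fst_comp (hdj y) hy v).2, hker]) hx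
  rw [(chartAt (EuclideanSpace ℝ (Fin d)) (F.ofM (j x))).continuousAt_iff_continuousAt_comp_left]
  · have h1 : ContinuousAt (fun y => (Θ (j y)).2) x :=
      continuous_snd.continuousAt.comp
        ((Θ.continuousAt hx).comp hj.continuous.continuousAt)
    exact h1
  · filter_upwards [hev, hs.mem_nhds hx] with y hy hys
    exact ⟨hys, hy⟩

/-- The connected component of `p` in the leaf topology, as an open subset. -/
def leaf (p : F.LeafSpace) : TopologicalSpace.Opens F.LeafSpace :=
  ⟨connectedComponent p, by
    have := ChartedSpace.locallyConnectedSpace (EuclideanSpace ℝ (Fin d)) F.LeafSpace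
    exact isOpen_connectedComponent⟩

/-- The inclusion of the leaf. -/
def leafInclusion (p : F.LeafSpace) (x : F.leaf p) : M := F.toM x.1

lemma isKernelImmersion_leafInclusion (hne : ∀ x, α x ≠ 0) (p : F.LeafSpace) :
    IsKernelImmersion d α (F.leafInclusion p) := by
  refine isKernelImmersion_of_slices hne fun x => ?_
  refine ⟨F.chart (F.toM x.1), (F.chart (F.toM x.1) (F.toM x.1)).1, F.adapted _, fun y hy => ?_⟩
  have hy' : y.1 ∈ (chartAt (EuclideanSpace ℝ (Fin d)) x.1).source := by
    simpa [TopologicalSpace.Opens.chartAt_eq] using hy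
  rw [F.chartAt_source] at hy'
  exact ⟨hy'.1, Prod.ext hy'.2 rfl⟩

/-- The leaf through a point is a maximal connected integral manifold. -/
theorem isLeaf_leafInclusion (hne : ∀ x, α x ≠ 0)
    {D : Π x : M, Submodule ℝ (TangentSpace (𝓡 (d + 1)) x)}
    (hD : ∀ x v, v ∈ D x ↔ α x v = 0) (p : F.LeafSpace) :
    IsLeaf d D (F.leafInclusion p) := by
  have hk := F.isKernelImmersion_leafInclusion hne p
  refine { connected := ?_, smooth := hk.smooth, injective := ?_, immersion := hk.immersion,
           tangent := ?_, maximal := ?_ }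
  · exact Subtype.connectedSpace isConnected_connectedComponent
  · exact fun x y hxy => Subtype.ext hxy
  · intro x
    ext v
    rw [hk.mem_range, hD]
  · intro N _ _ _ j hj hsub
    have hc := F.continuous_toLeafSpace hj.smooth fun x v =>
      (hD _ _).1 ((hj.tangent x) ▸ ⟨v, rfl⟩)
    have := hj.connected
    have hr : IsPreconnected (range (fun x => F.ofM (j x))) := isPreconnected_range hc
    have hp : p ∈ range (fun x => F.ofM (j x)) := hsub ⟨⟨p, mem_connectedComponent⟩, rfl⟩
    rintro _ ⟨x, rfl⟩
    exact ⟨⟨j x, hr.subset_connectedComponent hp ⟨x, rfl⟩⟩, rfl⟩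

end AdaptedFamily

/-- Through every point there is a leaf of the kernel of a nowhere vanishing closed form. -/
theorem exists_isLeaf [IsManifold (𝓡 (d + 1)) ∞ M] (hα : SmoothOneForm (𝓡 (d + 1)) α)
    (hd : ∀ x v w, extD α x ![v, w] = 0) (hne : ∀ x, α x ≠ 0)
    {D : Π x : M, Submodule ℝ (TangentSpace (𝓡 (d + 1)) x)}
    (hD : ∀ x v, v ∈ D x ↔ α x v = 0) (p : M) :
    ∃ (L : Type u) (_ : TopologicalSpace L) (_ : ChartedSpace (EuclideanSpace ℝ (Fin d)) L)
      (_ : IsManifold (𝓡 d) ∞ L) (i : L → M), IsLeaf d D i ∧ p ∈ range i := by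
  choose Θ hmem hΘ using exists_isAdaptedChart hα hd hne
  let F : AdaptedFamily α := ⟨Θ, hmem, hΘ⟩
  exact ⟨F.leaf p, inferInstance, inferInstance, inferInstance, F.leafInclusion p,
    F.isLeaf_leafInclusion hne hD p, ⟨⟨p, mem_connectedComponent⟩, rfl⟩⟩

end Leaf

section Main

variable {d h : ℕ} {M : Type u} [TopologicalSpace M] [T2Space M]
  [ChartedSpace (EuclideanSpace ℝ (Fin (d + 1))) M] [IsManifold (𝓡 (d + 1)) ∞ M]

omit [T2Space M] in
lemma IsLeaf.isKernelImmersion {S : ContactPairStructure (d + 1) h 0 M} {L : Type u}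
    [TopologicalSpace L] [ChartedSpace (EuclideanSpace ℝ (Fin d)) L] {i : L → M}
    (hi : IsLeaf d (charDistribution S.α₂) i) : IsKernelImmersion d S.α₂ i where
  smooth := hi.smooth
  immersion := hi.immersion
  mem_range x v := by rw [hi.tangent x, mem_charDistribution_iff]

/-- A contact pair structure of type `(h, 0)` that is invariant under `Z₂` is normal if and only
if it induces normal almost contact structures on the leaves of the second characteristic
foliation. -/
theorem isNormal_iff_leaves (S : ContactPairStructure (d + 1) h 0 M)
    (hL : LieDerivEndoVanishes (𝓡 (d + 1)) S.Z₂ S.φ) :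
    S.IsNormal ↔
      ∀ (L : Type u) [TopologicalSpace L] [ChartedSpace (EuclideanSpace ℝ (Fin d)) L]
        [IsManifold (𝓡 d) ∞ L] (i : L → M), IsLeaf d (charDistribution S.α₂) i →
        ∃ A : AlmostContactStructure d L, IsInduced S i A ∧ A.IsNormal := by
  have hF := S.isInvariantFrame hL
  constructor
  · rintro ⟨hJ, -⟩ L _ _ _ i hi
    have hk := hi.isKernelImmersion
    obtain ⟨A, hα, hZ, hφ⟩ := hk.exists_induced hF
    exact ⟨A, ⟨hα, hZ, hφ⟩, hk.isNormal_of_nijenhuisVanishes hF hα hZ hφ hJ⟩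
  · intro hleaf
    have hne (x : M) : S.α₂ x ≠ 0 := fun h0 => by
      have h1 := hF.β_ζ x
      rw [h0] at h1
      exact zero_ne_one h1
    have key (p : M) : ∃ (L : Type u) (_ : TopologicalSpace L)
        (_ : ChartedSpace (EuclideanSpace ℝ (Fin d)) L) (_ : IsManifold (𝓡 d) ∞ L) (i : L → M)
        (A : AlmostContactStructure d L), IsKernelImmersion d S.α₂ i ∧ IsInduced S i A ∧
          A.IsNormal ∧ ∃ x, i x = p := by
      obtain ⟨L, _, _, _, i, hi, x, hx⟩ := exists_isLeaf hF.smooth_β (extD_α₂_eq_zero S) hne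
        (mem_charDistribution_iff S) p
      obtain ⟨A, hA, hN⟩ := hleaf L i hi
      exact ⟨L, _, _, _, i, A, hi.isKernelImmersion, hA, hN, x, hx⟩
    constructor
    · intro V W hV hW p
      obtain ⟨L, _, _, _, i, A, hk, hA, hN, x, rfl⟩ := key p
      exact hk.nijenhuis_eq_zero_of_isNormal hF hA.form hA.reeb hA.tensor hN hV hW x
    · intro V W hV hW p
      obtain ⟨L, _, _, _, i, A, hk, hA, hN, x, rfl⟩ := key p
      rw [S.T_eq_twist]
      exact hk.neg.nijenhuis_eq_zero_of_isNormal hF.neg hA.form hA.reeb hA.tensor hN hV hW x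

end Main

end ContactPairs

end

theorem mainTheorem9 {h : ℕ} {M : Type u} [TopologicalSpace M] [T2Space M]
    [SecondCountableTopology M] [ChartedSpace (EuclideanSpace ℝ (Fin (2 * h + 2))) M]
    [IsManifold (𝓡 (2 * h + 2)) ∞ M]
    (S : ContactPairs.ContactPairStructure (2 * h + 2) h 0 M)
    (hL : ContactPairs.LieDerivEndoVanishes (𝓡 (2 * h + 2)) S.Z₂ S.φ) :
    S.IsNormal ↔
      ∀ (L : Type u) [TopologicalSpace L] [ChartedSpace (EuclideanSpace ℝ (Fin (2 * h + 1))) L]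
        [IsManifold (𝓡 (2 * h + 1)) ∞ L] (i : L → M),
        ContactPairs.IsLeaf (2 * h + 1) (ContactPairs.charDistribution S.α₂) i →
        ∃ A : ContactPairs.AlmostContactStructure (2 * h + 1) L, ContactPairs.IsInduced S i A ∧ A.IsNormal :=
  ContactPairs.isNormal_iff_leaves (d := 2 * h + 1) S hL
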